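/- Let $G$ be a finite group acting linearly on a finite-dimensional complex vector space $V$ with basis $v_1,\ldots,v_n$, and let $\mathbf q=(q_{ij})_{1\le i,j\le n}$ be nonzero complex numbers with $q_{ii}=1$ and $q_{ji}=q_{ij}^{-1}$ for all $i,j$. Put $$S_{\mathbf q}(V)=\mathbb C\langle v_1,\ldots,v_n\mid v_iv_j=q_{ij}v_jv_i\ \text{for all } i,j\rangle,\qquad \textstyle\bigwedge_{\mathbf q}(V)=\mathbb C\langle v_1,\ldots,v_n\mid v_iv_j=-q_{ij}v_jv_i\ \text{for all } i,j\rangle .$$ Assume that the action of $G$ on $V$ extends to an action on $S_{\mathbf q}(V)$ by algebra automorphisms, and let $S_{\mathbf q}(V)\rtimes G$ be the skew group algebra: the free left $S_{\mathbf q}(V)$-module with basis $G$ and product $(ag)(bh)=a\,({}^{g}b)\,gh$, graded by $\deg v_i=1$ and $\deg g=0$ for $g\in G$. For a $\mathbb C$-algebra $R$, a Hochschild 2-cocycle on $R$ is a $\mathbb C$-linear map $\alpha:R\otimes R\to R$ with $$\alpha(r\otimes s)u+\alpha(rs\otimes u)=\alpha(r\otimes su)+r\alpha(s\otimes u)\qquad\text{for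 all } r,s,u\in R .$$ A Hochschild 2-cocycle on $S_{\mathbf q}(V)\rtimes G$ is constant if it is homogeneous of degree $-2$ as a map from $(S_{\mathbf q}(V)\rtimes G)^{\otimes 2}$ to $S_{\mathbf q}(V)\rtimes G$. A deformation of $R$ over $\mathbb C[t]$ is an associative (unital) $\mathbb C[t]$-algebra with underlying $\mathbb C[t]$-module $R[t]=\mathbb C[t]\otimes R$ and with product $$r*s=rs+\mu_1(r\otimes s)t+\mu_2(r\otimes s)t^2+\cdots\qquad(r,s\in R),$$ where $rs$ is the product in $R$, the maps $\mu_i:R\otimes R\to R$ are $\mathbb C$-linear and extended to be $\mathbb C[t]$-linear, and the sum is finite for each $r,s$. **Theorem.** Assume that the action of $G$ on $V$ also extends to an action on $\bigwedge_{\mathbf q}(V)$ by algebra automorphisms. Then each constant Hochschild 2-cocycle $\alpha$ on $S_{\mathbf q}(V)\rtimes G$ lifts to a deformation of $S_{\mathbf q}(V)\rtimes G$ over $\mathbb C[t]$, that is, there is a deformation of $S_{\mathbf q}(V)\rtimes G$ over $\mathbb C[t]$ with $\mu_1=\alpha$. -/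

import Mathlib

open scoped TensorProduct Polynomial

noncomputable section

/-- The relations `x i * x j = c i j • (x j * x i)` (for all `i, j`) on the free algebra
`ℂ⟨x_1, …, x_n⟩`. -/
inductive SkewCommRel {n : ℕ} (c : Fin n → Fin n → ℂ) :
    FreeAlgebra ℂ (Fin n) → FreeAlgebra ℂ (Fin n) → Prop
  | swap (i j : Fin n) :
      SkewCommRel c (FreeAlgebra.ι ℂ i * FreeAlgebra.ι ℂ j)
        (c i j • (FreeAlgebra.ι ℂ j * FreeAlgebra.ι ℂ i))

/-- The algebra `ℂ⟨x_1, …, x_n | x_i x_j = c_{ij} x_j x_i for all i, j⟩`. -/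
abbrev SkewCommAlgebra {n : ℕ} (c : Fin n → Fin n → ℂ) : Type :=
  RingQuot (SkewCommRel c)

/-- The generator `x_i` of `ℂ⟨x_1, …, x_n | x_i x_j = c_{ij} x_j x_i⟩`. -/
def SkewCommAlgebra.gen {n : ℕ} (c : Fin n → Fin n → ℂ) (i : Fin n) : SkewCommAlgebra c :=
  RingQuot.mkAlgHom ℂ (SkewCommRel c) (FreeAlgebra.ι ℂ i)

/-- The linear map `V → ℂ⟨x_1, …, x_n | x_i x_j = c_{ij} x_j x_i⟩` sending the chosen basis
vector `v_i` of `V` to the generator `x_i`. -/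
def SkewCommAlgebra.incl {n : ℕ} {V : Type*} [AddCommGroup V] [Module ℂ V]
    (v : Module.Basis (Fin n) ℂ V) (c : Fin n → Fin n → ℂ) : V →ₗ[ℂ] SkewCommAlgebra c :=
  v.constr ℂ (SkewCommAlgebra.gen c)

/-- The quantum symmetric algebra
`S_q(V) = ℂ⟨v_1, …, v_n | v_i v_j = q_{ij} v_j v_i for all i, j⟩`. -/
abbrev QuantumSym {n : ℕ} (q : Fin n → Fin n → ℂ) : Type :=
  SkewCommAlgebra q

/-- The quantum exterior algebra
`⋀_q(V) = ℂ⟨v_1, …, v_n | v_i v_j = - q_{ij} v_j v_i for all i, j⟩`. -/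
abbrev QuantumExt {n : ℕ} (q : Fin n → Fin n → ℂ) : Type :=
  SkewCommAlgebra (fun i j => - q i j)

/-- The homogeneous component of `S_q(V)` of degree `d ∈ ℤ` for the grading with every `v_i` in
degree `1`: the span of all products of `d` generators for `d ≥ 0`, and zero for `d < 0`. -/
def QuantumSym.piece {n : ℕ} (q : Fin n → Fin n → ℂ) : ℤ → Submodule ℂ (QuantumSym q)
  | Int.ofNat m => (Submodule.span ℂ (Set.range (SkewCommAlgebra.gen q))) ^ m
  | Int.negSucc _ => ⊥

/-- The skew group algebra `A ⋊ G`: the free left `A`-module on `G` with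
`(a g) (b h) = a (g • b) (g h)`. The element `a g` is `SkewMonoidAlgebra.single g a`. -/
abbrev SkewGroupAlgebra (A G : Type*) [Zero A] : Type _ :=
  SkewMonoidAlgebra A G

/-- The homogeneous component of degree `d ∈ ℤ` of `S_q(V) ⋊ G`, every `v_i` having degree `1` and
every `g ∈ G` degree `0`: the sums `∑ a_g g` in which every `a_g` is homogeneous of degree `d`. -/
def skewPiece {n : ℕ} (q : Fin n → Fin n → ℂ) (G : Type*) (d : ℤ) :
    Submodule ℂ (SkewGroupAlgebra (QuantumSym q) G) where
  carrier := {x | ∀ g : G, x.coeff g ∈ QuantumSym.piece q d}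
  zero_mem' := fun g => by simp
  add_mem' := fun {x y} hx hy g => by
    simpa using Submodule.add_mem _ (hx g) (hy g)
  smul_mem' := fun c x hx g => by
    simpa using Submodule.smul_mem _ c (hx g)

/-- A bilinear map `α` on an algebra `R` (a linear map `R ⊗ R → R`) is a Hochschild 2-cocycle. -/
def IsHochschildTwoCocycle {R : Type*} [Ring R] [Algebra ℂ R] (α : R →ₗ[ℂ] R →ₗ[ℂ] R) : Prop :=
  ∀ r s u : R, α r s * u + α (r * s) u = α r (s * u) + r * α s u

/-- A bilinear map on `S_q(V) ⋊ G` is constant if it is homogeneous of degree `-2` as a map from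
`(S_q(V) ⋊ G) ⊗ (S_q(V) ⋊ G)`, with its total grading, to `S_q(V) ⋊ G`. -/
def IsConstantCochain {n : ℕ} {q : Fin n → Fin n → ℂ} {G : Type*}
    (α : SkewGroupAlgebra (QuantumSym q) G →ₗ[ℂ]
      SkewGroupAlgebra (QuantumSym q) G →ₗ[ℂ] SkewGroupAlgebra (QuantumSym q) G) : Prop :=
  ∀ (d e : ℤ) (x y : SkewGroupAlgebra (QuantumSym q) G),
    x ∈ skewPiece q G d → y ∈ skewPiece q G e → α x y ∈ skewPiece q G (d + e - 2)

/-- A deformation over `ℂ[t]` of a `ℂ`-algebra `R`: an associative unital `ℂ[t]`-algebra structure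
on the `ℂ[t]`-module `R[t] = ℂ[t] ⊗ R` whose product satisfies
`r * s = r s + μ₁(r, s) t + μ₂(r, s) t² + ⋯` for `r, s ∈ R`, where the `μ i` are `ℂ`-bilinear and
the sum is finite for each `r` and `s`. -/
structure Deformation (R : Type*) [Ring R] [Algebra ℂ R] where
  /-- The product, a `ℂ[t]`-bilinear map. -/
  mul : (ℂ[X] ⊗[ℂ] R) →ₗ[ℂ[X]] (ℂ[X] ⊗[ℂ] R) →ₗ[ℂ[X]] (ℂ[X] ⊗[ℂ] R)
  mul_assoc : ∀ x y z, mul (mul x y) z = mul x (mul y z)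
  /-- The identity element. -/
  one : ℂ[X] ⊗[ℂ] R
  one_mul : ∀ x, mul one x = x
  mul_one : ∀ x, mul x one = x
  /-- The coefficient maps of the product. -/
  μ : ℕ → R →ₗ[ℂ] R →ₗ[ℂ] R
  μ_zero : ∀ r s, μ 0 r s = r * s
  mul_eq : ∀ r s : R, ∃ N : ℕ, (∀ i, N ≤ i → μ i r s = 0) ∧
    mul (1 ⊗ₜ[ℂ] r) (1 ⊗ₜ[ℂ] s) =
      ∑ i ∈ Finset.range N, (Polynomial.X ^ i : ℂ[X]) ⊗ₜ[ℂ] μ i r s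

end

open scoped TensorProduct Polynomial

set_option linter.unusedSectionVars false

/-! Write R for S_q(V) ⋊ G and c for the cocycle. The deformation is the quotient H of ℂ⟨v_1, …,
v_n⟩[t] ⋊ G by the relations v_i v_j - q_ij v_j v_i = t (c(v_i, v_j) - q_ij c(v_j, v_i)),
homogeneous once t has degree 2. Since c lowers degrees by 2, the elements c(v_i, v_j) lie in ℂG.

First order information comes from the square-zero extension of R defined by c. The free algebra
maps to it with t ↦ (0, 1), and the relations go to 0. Hence if t e lies in the ideal of relations,
e vanishes at t = 0. In degrees 0 and 1 the specialization t = 0 is injective on t-multiples'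
cofactors e, so such an e is itself 0. This yields two exact identities: stability of the relations
under G (`grp_mul_rel`) and a Jacobi identity (`jacobi`). The obstruction to flatness is t times an
element of degree 1, so no condition of higher order in t appears.

The core is that t is a non-zero-divisor on H (`mem_relIdeal_of_t_mul_mem`), by induction on the
degree. If t x is a combination of relations, its coefficients give a cycle in the Koszul complex of
S_q(V). That complex is exact at this spot by an Euler homotopy built from skew partial derivatives
(`exists_koszul_lift`). The Jacobi identity then reduces x to elements of lower degree.

Finally `exists_deformation_of_flat` identifies H with ℂ[t] ⊗ R by a section that maps r to (r, 0)
in the square-zero extension, so that the first order term is c itself and not only a cohomologous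
cocycle. -/

/-! ### Square-zero extensions defined by cocycles -/

/-- A Hochschild 2-cocycle on `R` that vanishes when one of its arguments is `1`. -/
structure UnitalTwoCocycle (R : Type*) [Ring R] [Algebra ℂ R] where
  /-- The underlying bilinear map. -/
  toFun : R →ₗ[ℂ] R →ₗ[ℂ] R
  cocycle : IsHochschildTwoCocycle toFun
  one_left : ∀ r, toFun 1 r = 0
  one_right : ∀ r, toFun r 1 = 0

/-- The square-zero extension of `R` by `R` defined by a 2-cocycle `c`: the space `R × R` with
`(a, b) (a', b') = (a a', a b' + b a' + c(a, a'))`. -/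
def TwistedExt {R : Type*} [Ring R] [Algebra ℂ R] (_c : UnitalTwoCocycle R) : Type _ := R × R

namespace TwistedExt

variable {R : Type*} [Ring R] [Algebra ℂ R] {c : UnitalTwoCocycle R}

instance : AddCommGroup (TwistedExt c) := inferInstanceAs (AddCommGroup (R × R))

instance : Module ℂ (TwistedExt c) := inferInstanceAs (Module ℂ (R × R))

/-- The element `(a, b)` of the extension. -/
def mk (c : UnitalTwoCocycle R) (a b : R) : TwistedExt c := (a, b)

/-- The first component. -/
def fst (x : TwistedExt c) : R := Prod.fst x

/-- The second component. -/
def snd (x : TwistedExt c) : R := Prod.snd x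

@[ext] theorem ext {x y : TwistedExt c} (h₁ : x.fst = y.fst) (h₂ : x.snd = y.snd) : x = y :=
  Prod.ext h₁ h₂

@[simp] theorem fst_mk (a b : R) : (mk c a b).fst = a := rfl
@[simp] theorem snd_mk (a b : R) : (mk c a b).snd = b := rfl
@[simp] theorem fst_add (x y : TwistedExt c) : (x + y).fst = x.fst + y.fst := rfl
@[simp] theorem snd_add (x y : TwistedExt c) : (x + y).snd = x.snd + y.snd := rfl
@[simp] theorem fst_sub (x y : TwistedExt c) : (x - y).fst = x.fst - y.fst := rfl
@[simp] theorem snd_sub (x y : TwistedExt c) : (x - y).snd = x.snd - y.snd := rfl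
@[simp] theorem fst_zero : (0 : TwistedExt c).fst = 0 := rfl
@[simp] theorem snd_zero : (0 : TwistedExt c).snd = 0 := rfl
@[simp] theorem fst_smul (z : ℂ) (x : TwistedExt c) : (z • x).fst = z • x.fst := rfl
@[simp] theorem snd_smul (z : ℂ) (x : TwistedExt c) : (z • x).snd = z • x.snd := rfl

instance : One (TwistedExt c) := ⟨mk c 1 0⟩

instance : Mul (TwistedExt c) :=
  ⟨fun x y => mk c (x.fst * y.fst) (x.fst * y.snd + x.snd * y.fst + c.toFun x.fst y.fst)⟩

@[simp] theorem fst_one : (1 : TwistedExt c).fst = 1 := rfl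
@[simp] theorem snd_one : (1 : TwistedExt c).snd = 0 := rfl
@[simp] theorem fst_mul (x y : TwistedExt c) : (x * y).fst = x.fst * y.fst := rfl
@[simp] theorem snd_mul (x y : TwistedExt c) :
    (x * y).snd = x.fst * y.snd + x.snd * y.fst + c.toFun x.fst y.fst := rfl

/-- Associativity in the second component is exactly the cocycle identity; the unit laws need the
cocycle to vanish on 1. -/
instance : Ring (TwistedExt c) where
  __ := (inferInstance : AddCommGroup (TwistedExt c))
  mul_assoc x y z := by
    ext
    · simp [mul_assoc]
    · have h := c.cocycle x.fst y.fst z.fst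
      simp only [snd_mul, fst_mul, mul_add, add_mul]
      rw [eq_sub_of_add_eq' h]
      simp only [mul_assoc]
      abel
  one_mul x := by ext <;> simp [c.one_left]
  mul_one x := by ext <;> simp [c.one_right]
  zero_mul x := by ext <;> simp
  mul_zero x := by ext <;> simp
  left_distrib x y z := by
    ext
    · simp [mul_add]
    · simp only [snd_mul, fst_add, snd_add, mul_add, map_add]; abel
  right_distrib x y z := by
    ext
    · simp [add_mul]
    · simp only [snd_mul, fst_add, snd_add, add_mul, map_add, LinearMap.add_apply]; abel

instance : Algebra ℂ (TwistedExt c) :=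
  Algebra.ofModule
    (fun z x y => by ext <;> simp [smul_add])
    (fun z x y => by ext <;> simp [smul_add])

/-- The projection of the extension onto `R`. -/
def fstHom (c : UnitalTwoCocycle R) : TwistedExt c →ₐ[ℂ] R where
  toFun := fst
  map_one' := rfl
  map_mul' _ _ := rfl
  map_zero' := rfl
  map_add' _ _ := rfl
  commutes' z := by simp [Algebra.algebraMap_eq_smul_one]

@[simp] theorem fstHom_apply (x : TwistedExt c) : fstHom c x = x.fst := rfl

/-- The second component, as a linear map. -/
def sndHom (c : UnitalTwoCocycle R) : TwistedExt c →ₗ[ℂ] R where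
  toFun := snd
  map_add' _ _ := rfl
  map_smul' _ _ := rfl

@[simp] theorem sndHom_apply (x : TwistedExt c) : sndHom c x = x.snd := rfl

end TwistedExt

/-! ### Deformations from flat families over ℂ[t] -/

section coeffTensor

variable {R : Type*} [AddCommGroup R] [Module ℂ R]

/-- The coefficient of `X ^ i` of an element of `ℂ[X] ⊗ R`. -/
noncomputable def coeffTensor (R : Type*) [AddCommGroup R] [Module ℂ R] (i : ℕ) :
    ℂ[X] ⊗[ℂ] R →ₗ[ℂ] R :=
  (TensorProduct.lid ℂ R).toLinearMap ∘ₗ (Polynomial.lcoeff ℂ i).rTensor R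

@[simp] theorem coeffTensor_tmul (i : ℕ) (p : ℂ[X]) (r : R) :
    coeffTensor R i (p ⊗ₜ r) = p.coeff i • r := by
  simp [coeffTensor]

theorem exists_eq_sum_coeffTensor (z : ℂ[X] ⊗[ℂ] R) :
    ∃ N : ℕ, (∀ i, N ≤ i → coeffTensor R i z = 0) ∧
      z = ∑ i ∈ Finset.range N, (Polynomial.X ^ i : ℂ[X]) ⊗ₜ[ℂ] coeffTensor R i z := by
  -- Allowing every K ≥ N lets two summands be written with a common length.
  suffices h : ∃ N : ℕ, ∀ K, N ≤ K → (∀ i, K ≤ i → coeffTensor R i z = 0) ∧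
      z = ∑ i ∈ Finset.range K, (Polynomial.X ^ i : ℂ[X]) ⊗ₜ[ℂ] coeffTensor R i z by
    obtain ⟨N, hN⟩ := h
    exact ⟨N, hN N le_rfl⟩
  induction z with
  | zero => exact ⟨0, by simp⟩
  | add x y hx hy =>
    obtain ⟨N, hN⟩ := hx
    obtain ⟨N', hN'⟩ := hy
    refine ⟨max N N', fun K hK => ?_⟩
    obtain ⟨h1, h2⟩ := hN K (le_trans (le_max_left _ _) hK)
    obtain ⟨h3, h4⟩ := hN' K (le_trans (le_max_right _ _) hK)
    refine ⟨fun i hi => by simp [h1 i hi, h3 i hi], ?_⟩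
    simp only [map_add, TensorProduct.tmul_add, Finset.sum_add_distrib]
    rw [← h2, ← h4]
  | tmul p r =>
    refine ⟨p.natDegree + 1, fun K hK => ⟨fun i hi => ?_, ?_⟩⟩
    · simp [Polynomial.coeff_eq_zero_of_natDegree_lt (show p.natDegree < i by omega)]
    · conv_lhs => rw [p.as_sum_range' K (by omega), TensorProduct.sum_tmul]
      refine Finset.sum_congr rfl fun i _ => ?_
      rw [coeffTensor_tmul, ← TensorProduct.smul_tmul, Polynomial.smul_X_eq_monomial]

theorem exists_coeffTensor_eq_sum {H : Type*} [AddCommGroup H] [Module ℂ H] [Module ℂ[X] H]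
    [IsScalarTower ℂ ℂ[X] H] (σ : R →ₗ[ℂ] H) (z : ℂ[X] ⊗[ℂ] R) (N : ℕ)
    (h : z = ∑ i ∈ Finset.range N, (Polynomial.X ^ i : ℂ[X]) ⊗ₜ[ℂ] coeffTensor R i z) :
    σ.liftBaseChange ℂ[X] z =
      ∑ i ∈ Finset.range N, (Polynomial.X ^ i : ℂ[X]) • σ (coeffTensor R i z) := by
  conv_lhs => rw [h]
  simp

end coeffTensor

/-- An algebra `H` with a central non-zero-divisor `t` and a linear map `σ : R → H` whose range
generates `H` over `ℂ[t]` gives a deformation of `R`, whose first order term is read off from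
the homomorphism to the square-zero extension. -/
theorem exists_deformation_of_flat {R H : Type*} [Ring R] [Algebra ℂ R] [Ring H] [Algebra ℂ H]
    (c : UnitalTwoCocycle R) (t : H) (ht : ∀ h, t * h = h * t) (σ : R →ₗ[ℂ] H)
    (π : H →ₐ[ℂ] TwistedExt c) (hπσ : ∀ r, π (σ r) = TwistedExt.mk c r 0)
    (hπt : π t = TwistedExt.mk c 0 1) (hreg : ∀ h, t * h = 0 → h = 0)
    (hgen : ∀ P : Submodule ℂ H, (∀ r, σ r ∈ P) → (∀ h ∈ P, t * h ∈ P) → P = ⊤) :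
    ∃ D : Deformation R, D.μ 1 = c.toFun := by
  let _ : Algebra ℂ[X] H := ((Polynomial.aeval t : ℂ[X] →ₐ[ℂ] H) : ℂ[X] →+* H).toAlgebra' (by
    intro p h
    induction p using Polynomial.induction_on' with
    | add p q hp hq => simpa [mul_add, add_mul] using congrArg₂ (· + ·) hp hq
    | monomial n a =>
      have := (Commute.pow_left (ht h : Commute t h) n).eq
      simp [Polynomial.aeval_monomial, mul_assoc, this, Algebra.left_comm])
  have hsm : ∀ (p : ℂ[X]) (h : H), p • h = Polynomial.aeval t p * h := fun p h =>
    Algebra.smul_def p h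
  have _ : IsScalarTower ℂ ℂ[X] H := IsScalarTower.of_algebraMap_eq fun z => by
    change _ = Polynomial.aeval t (Polynomial.C z)
    simp
  have hX : ∀ h : H, (Polynomial.X : ℂ[X]) • h = t * h := fun h => by simp [hsm]
  set Θ : ℂ[X] ⊗[ℂ] R →ₗ[ℂ[X]] H := σ.liftBaseChange ℂ[X] with hΘ
  have hπX : ∀ h, (π ((Polynomial.X : ℂ[X]) • h)) = TwistedExt.mk c 0 (π h).fst := fun h => by
    rw [hX, map_mul, hπt]; ext <;> simp
  -- The first component of π kills multiples of t and so isolates r 0; a factor t is then cancelled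
  -- by `hreg`.
  have hinj' : ∀ (N : ℕ) (r : ℕ → R),
      ∑ i ∈ Finset.range N, (Polynomial.X ^ i : ℂ[X]) • σ (r i) = 0 → ∀ i < N, r i = 0 := by
    intro N
    induction N with
    | zero => simp
    | succ N ih =>
      intro r hr
      have e : ∑ i ∈ Finset.range N, (Polynomial.X ^ (i + 1) : ℂ[X]) • σ (r (i + 1)) =
          (Polynomial.X : ℂ[X]) •
            ∑ i ∈ Finset.range N, (Polynomial.X ^ i : ℂ[X]) • σ (r (i + 1)) := by
        rw [Finset.smul_sum]
        exact Finset.sum_congr rfl fun i _ => by rw [smul_smul, pow_succ']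
      rw [Finset.sum_range_succ', e] at hr
      have h0 : r 0 = 0 := by
        have := congrArg (fun h => (π h).fst) hr
        simpa [hπX, hπσ] using this
      rw [h0] at hr
      have h1 := ih (fun i => r (i + 1)) (hreg _ (by simpa [hX] using hr))
      rintro (_ | i) hi
      · exact h0
      · exact h1 i (by omega)
  have hinj : Function.Injective Θ := by
    rw [← LinearMap.ker_eq_bot, LinearMap.ker_eq_bot']
    intro z hz
    obtain ⟨N, -, h⟩ := exists_eq_sum_coeffTensor z
    rw [hΘ, exists_coeffTensor_eq_sum σ z N h] at hz
    have := hinj' N (fun i => coeffTensor R i z) hz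
    rw [h]
    exact Finset.sum_eq_zero fun i hi => by rw [this i (Finset.mem_range.1 hi)]; simp
  have hsurj : Function.Surjective Θ := by
    have := hgen ((LinearMap.range Θ).restrictScalars ℂ)
      (fun r => ⟨1 ⊗ₜ r, by simp [hΘ]⟩)
      (fun h hh => by
        rw [← hX]
        exact (LinearMap.range Θ).smul_mem _ hh)
    intro h
    have hh : h ∈ (LinearMap.range Θ).restrictScalars ℂ := by rw [this]; trivial
    exact hh
  let e : (ℂ[X] ⊗[ℂ] R) ≃ₗ[ℂ[X]] H := LinearEquiv.ofBijective Θ ⟨hinj, hsurj⟩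
  have he : ∀ z, e z = Θ z := fun _ => rfl
  -- On the extension t acts by (a, b) ↦ (0, a), whose square is zero, so π sees exactly the
  -- coefficients of 1 and t.
  have hπΘ : ∀ z, π (Θ z) = TwistedExt.mk c (coeffTensor R 0 z) (coeffTensor R 1 z) := by
    intro z
    induction z with
    | zero => simp; rfl
    | add x y hx hy => simp only [map_add, hx, hy]; rfl
    | tmul p r =>
      induction p using Polynomial.induction_on' with
      | add p q hp hq => simp only [TensorProduct.add_tmul, map_add, hp, hq]; rfl
      | monomial n a =>
        rw [hΘ, LinearMap.liftBaseChange_tmul, ← Polynomial.smul_X_eq_monomial, smul_assoc,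
          map_smul]
        rcases n with _ | _ | n
        · rw [pow_zero, one_smul, hπσ]
          ext <;> simp [Polynomial.coeff_one]
        · rw [zero_add, pow_one, hπX, hπσ]
          ext <;> simp
        · rw [pow_succ', pow_succ', ← smul_smul, ← smul_smul, hπX, hπX]
          ext <;> simp [Polynomial.coeff_X_pow, ← pow_succ']
  let m : (ℂ[X] ⊗[ℂ] R) →ₗ[ℂ[X]] (ℂ[X] ⊗[ℂ] R) →ₗ[ℂ[X]] (ℂ[X] ⊗[ℂ] R) :=
    ((LinearMap.mul ℂ[X] H).compl₁₂ e.toLinearMap e.toLinearMap).compr₂ e.symm.toLinearMap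
  have hm : ∀ x y, m x y = e.symm (e x * e y) := fun _ _ => rfl
  let ν : ℕ → R →ₗ[ℂ] R →ₗ[ℂ] R := fun i =>
    (((LinearMap.mul ℂ H).compl₁₂ σ σ).compr₂ (e.symm.toLinearMap.restrictScalars ℂ)).compr₂
      (coeffTensor R i)
  have hν : ∀ i r s, ν i r s = coeffTensor R i (e.symm (σ r * σ s)) := fun _ _ _ => rfl
  -- Both coefficients are read off at once from (r, 0)(s, 0) = (r s, c(r, s)).
  have hπν : ∀ r s, TwistedExt.mk c (ν 0 r s) (ν 1 r s) = TwistedExt.mk c (r * s) (c.toFun r s) := by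
    intro r s
    rw [hν, hν, ← hπΘ, ← he, e.apply_symm_apply, map_mul, hπσ, hπσ]
    ext <;> simp
  refine ⟨{ mul := m
            mul_assoc := fun x y z => by simp [hm, mul_assoc]
            one := e.symm 1
            one_mul := fun x => by simp [hm]
            mul_one := fun x => by simp [hm]
            μ := ν
            μ_zero := fun r s => congrArg TwistedExt.fst (hπν r s)
            mul_eq := fun r s => ?_ }, ?_⟩
  · have hσ : ∀ r, e (1 ⊗ₜ r) = σ r := fun r => by simp [he, hΘ]
    obtain ⟨N, h1, h2⟩ := exists_eq_sum_coeffTensor (e.symm (σ r * σ s))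
    refine ⟨N, h1, ?_⟩
    rw [hm, hσ, hσ]
    exact h2
  · ext r s
    exact congrArg TwistedExt.snd (hπν r s)

/-! ### Free and quantum symmetric algebras, skew derivations -/

noncomputable section

/-- The operator `(x, y) ↦ (a x + b y, d y)` on `A × A`. -/
def triangularOp {A : Type*} [Ring A] [Algebra ℂ A] (a b d : A) : Module.End ℂ (A × A) :=
  LinearMap.prod (LinearMap.mulLeft ℂ a ∘ₗ LinearMap.fst ℂ A A +
    LinearMap.mulLeft ℂ b ∘ₗ LinearMap.snd ℂ A A) (LinearMap.mulLeft ℂ d ∘ₗ LinearMap.snd ℂ A A)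

@[simp] theorem triangularOp_apply {A : Type*} [Ring A] [Algebra ℂ A] (a b d : A) (x : A × A) :
    triangularOp a b d x = (a * x.1 + b * x.2, d * x.2) := rfl

/-- The polynomial ring in a central variable over the free algebra on `n` generators. -/
abbrev FreePoly (n : ℕ) : Type := Polynomial (FreeAlgebra ℂ (Fin n))

namespace FreePoly

variable {n : ℕ} {A : Type*} [Ring A] [Algebra ℂ A]

/-- The `i`-th free generator. -/
def var (i : Fin n) : FreePoly n := Polynomial.C (FreeAlgebra.ι ℂ i)

/-- The algebra homomorphism with prescribed values on the generators. -/
def lift (x : Fin n → A) (t : A) (h : ∀ i, x i * t = t * x i) : FreePoly n →ₐ[ℂ] A :=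
  Polynomial.eval₂AlgHom (FreeAlgebra.lift ℂ x) t fun a => by
    induction a with
    | grade0 r => exact (AlgHom.commutes (FreeAlgebra.lift ℂ x) r).symm ▸ Algebra.commutes r t
    | grade1 i => rw [FreeAlgebra.lift_ι_apply]; exact h i
    | mul a b ha hb => simpa using Commute.mul_left ha hb
    | add a b ha hb => simpa using Commute.add_left ha hb

@[simp] theorem lift_var (x : Fin n → A) (t : A) (h : ∀ i, x i * t = t * x i) (i : Fin n) :
    lift x t h (var i) = x i := by
  simp [lift, var]

@[simp] theorem lift_X (x : Fin n → A) (t : A) (h : ∀ i, x i * t = t * x i) :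
    lift x t h Polynomial.X = t := by
  simp [lift]

/-- Words are built from 1 by adding letters on the left; inductions on the cover rest on this. -/
theorem submodule_eq_top (P : Submodule ℂ (FreePoly n)) (h1 : 1 ∈ P)
    (hv : ∀ i, ∀ x ∈ P, var i * x ∈ P) (ht : ∀ x ∈ P, Polynomial.X * x ∈ P) : P = ⊤ := by
  have hC : ∀ a : FreeAlgebra ℂ (Fin n), ∀ x ∈ P, Polynomial.C a * x ∈ P := by
    intro a
    induction a with
    | grade0 r =>
      intro x hx
      have : Polynomial.C (algebraMap ℂ (FreeAlgebra ℂ (Fin n)) r) * x = r • x := by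
        rw [Algebra.smul_def]; rfl
      rw [this]
      exact P.smul_mem r hx
    | grade1 i => exact hv i
    | mul a b ha hb =>
      intro x hx
      rw [map_mul, mul_assoc]
      exact ha _ (hb x hx)
    | add a b ha hb =>
      intro x hx
      rw [map_add, add_mul]
      exact P.add_mem (ha x hx) (hb x hx)
  refine eq_top_iff.2 fun x _ => ?_
  induction x using Polynomial.induction_on' with
  | add p q hp hq => exact P.add_mem (hp trivial) (hq trivial)
  | monomial k a =>
    rw [← Polynomial.C_mul_X_pow_eq_monomial]
    refine hC a _ ?_
    clear * - h1 ht
    induction k with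
    | zero => simpa using h1
    | succ k ih => rw [pow_succ']; exact ht _ ih

theorem linearMap_ext {M : Type*} [AddCommGroup M] [Module ℂ M] {f g : FreePoly n →ₗ[ℂ] M}
    (h1 : f 1 = g 1) (hv : ∀ i x, f x = g x → f (var i * x) = g (var i * x))
    (ht : ∀ x, f x = g x → f (Polynomial.X * x) = g (Polynomial.X * x)) : f = g := by
  have := submodule_eq_top (LinearMap.eqLocus f g) h1 hv ht
  ext1 x
  have hx : x ∈ LinearMap.eqLocus f g := by rw [this]; trivial
  exact hx

/-- The homomorphism to the operators on `FreePoly n × FreePoly n` that defines the skew derivation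
along the `k`-th generator with twist `s`. -/
def skewDerivHom (s : Fin n → ℂ) (k : Fin n) :
    FreePoly n →ₐ[ℂ] Module.End ℂ (FreePoly n × FreePoly n) :=
  -- Multiplicativity of triangular matrices encodes the twisted Leibniz rule, so the derivation
  -- comes from the universal property.
  lift (fun j => triangularOp (s j • var j) (if j = k then 1 else 0) (var j))
    (triangularOp Polynomial.X 0 Polynomial.X) (fun j => by
      refine LinearMap.ext fun x => Prod.ext ?_ ?_ <;>
        simp [mul_add, mul_assoc, Polynomial.X_mul])

/-- The lower diagonal entry is plain left multiplication. Knowing the second component turns the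
first into the recursion for the derivation. -/
theorem skewDerivHom_snd (s : Fin n → ℂ) (k : Fin n) (x : FreePoly n) :
    (skewDerivHom s k x (0, 1)).2 = x := by
  have h : LinearMap.snd ℂ _ _ ∘ₗ LinearMap.applyₗ (0, 1) ∘ₗ (skewDerivHom s k).toLinearMap =
      LinearMap.id := by
    refine linearMap_ext (by simp) (fun i x hx => ?_) (fun x hx => ?_)
    · simpa [skewDerivHom] using congrArg (var i * ·) hx
    · simpa [skewDerivHom] using congrArg (Polynomial.X * ·) hx
  exact LinearMap.congr_fun h x

/-- The skew derivation along the `k`-th generator with twist `s`, the linear map `∂` with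
`∂ (v_j x) = δ_{jk} x + s_j v_j ∂ x`. -/
def skewDeriv (s : Fin n → ℂ) (k : Fin n) : FreePoly n →ₗ[ℂ] FreePoly n :=
  LinearMap.fst ℂ _ _ ∘ₗ LinearMap.applyₗ (0, 1) ∘ₗ (skewDerivHom s k).toLinearMap

@[simp] theorem skewDeriv_one (s : Fin n → ℂ) (k : Fin n) : skewDeriv s k 1 = 0 := by
  simp [skewDeriv]

theorem skewDeriv_var_mul (s : Fin n → ℂ) (j k : Fin n) (x : FreePoly n) :
    skewDeriv s k (var j * x) = (if j = k then x else 0) + s j • (var j * skewDeriv s k x) := by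
  have h := skewDerivHom_snd s k x
  simp only [skewDeriv, LinearMap.comp_apply, AlgHom.toLinearMap_apply, map_mul,
    LinearMap.applyₗ_apply_apply, Module.End.mul_apply, LinearMap.fst_apply]
  nth_rw 1 [skewDerivHom]
  simp [h, add_comm]

theorem skewDeriv_X_mul (s : Fin n → ℂ) (k : Fin n) (x : FreePoly n) :
    skewDeriv s k (Polynomial.X * x) = Polynomial.X * skewDeriv s k x := by
  simp only [skewDeriv, LinearMap.comp_apply, AlgHom.toLinearMap_apply, map_mul,
    LinearMap.applyₗ_apply_apply, Module.End.mul_apply, LinearMap.fst_apply]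
  nth_rw 1 [skewDerivHom]
  simp

end FreePoly

namespace SkewCommAlgebra

variable {n : ℕ} {c : Fin n → Fin n → ℂ} {A : Type*} [Ring A] [Algebra ℂ A]

theorem gen_mul_gen (c : Fin n → Fin n → ℂ) (i j : Fin n) :
    gen c i * gen c j = c i j • (gen c j * gen c i) := by
  have := RingQuot.mkAlgHom_rel ℂ (SkewCommRel.swap (c := c) i j)
  simpa [gen] using this

/-- The algebra homomorphism with prescribed values on the generators. -/
def lift (x : Fin n → A) (h : ∀ i j, x i * x j = c i j • (x j * x i)) :
    SkewCommAlgebra c →ₐ[ℂ] A :=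
  RingQuot.liftAlgHom ℂ ⟨FreeAlgebra.lift ℂ x, fun a b hab => by
    obtain ⟨i, j⟩ := hab
    simpa using h i j⟩

@[simp] theorem lift_gen (x : Fin n → A) (h : ∀ i j, x i * x j = c i j • (x j * x i))
    (i : Fin n) : lift x h (gen c i) = x i := by
  simp [lift, gen]

theorem submodule_eq_top (P : Submodule ℂ (SkewCommAlgebra c)) (h1 : 1 ∈ P)
    (hv : ∀ i, ∀ x ∈ P, gen c i * x ∈ P) : P = ⊤ := by
  have hC : ∀ a : FreeAlgebra ℂ (Fin n), ∀ x ∈ P, RingQuot.mkAlgHom ℂ (SkewCommRel c) a * x ∈ P := by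
    intro a
    induction a with
    | grade0 r =>
      intro x hx
      rw [AlgHom.commutes, ← Algebra.smul_def]
      exact P.smul_mem r hx
    | grade1 i => exact hv i
    | mul a b ha hb =>
      intro x hx
      rw [map_mul, mul_assoc]
      exact ha _ (hb x hx)
    | add a b ha hb =>
      intro x hx
      rw [map_add, add_mul]
      exact P.add_mem (ha x hx) (hb x hx)
  refine eq_top_iff.2 fun x _ => ?_
  obtain ⟨a, rfl⟩ := RingQuot.mkAlgHom_surjective ℂ (SkewCommRel c) x
  simpa using hC a 1 h1

theorem linearMap_ext {M : Type*} [AddCommGroup M] [Module ℂ M] {f g : SkewCommAlgebra c →ₗ[ℂ] M}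
    (h1 : f 1 = g 1) (hv : ∀ i x, f x = g x → f (gen c i * x) = g (gen c i * x)) : f = g := by
  have := submodule_eq_top (LinearMap.eqLocus f g) h1 hv
  ext1 x
  have hx : x ∈ LinearMap.eqLocus f g := by rw [this]; trivial
  exact hx

/-- The augmentation, sending all generators to zero. -/
def augmentation (c : Fin n → Fin n → ℂ) : SkewCommAlgebra c →ₐ[ℂ] ℂ :=
  lift (fun _ => 0) (by simp)

end SkewCommAlgebra

namespace QuantumSym

open SkewCommAlgebra

variable {n : ℕ} {q : Fin n → Fin n → ℂ}

variable (hd : ∀ i, q i i = 1) (hi : ∀ i j, q i j * q j i = 1)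

/-- The homomorphism to the operators on `S_q(V) × S_q(V)` that defines the skew partial derivative
along the `k`-th generator. -/
def skewDerivHom (k : Fin n) : QuantumSym q →ₐ[ℂ] Module.End ℂ (QuantumSym q × QuantumSym q) :=
  lift (fun j => triangularOp (q j k • gen q j) (if j = k then 1 else 0) (gen q j)) (fun i j => by
    have h : ∀ x, gen q i * (gen q j * x) = q i j • (gen q j * (gen q i * x)) := fun x => by
      rw [← mul_assoc, gen_mul_gen, smul_mul_assoc, mul_assoc]
    refine LinearMap.ext fun x => Prod.ext ?_ ?_
    -- The cases where an index equals k are those where q_kk = 1 and q_ij q_ji = 1 enter.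
    · have h1 := hi i j
      by_cases hik : i = k <;> by_cases hjk : j = k
      · subst hik; subst hjk; simp [hd]
      · subst hik
        simp only [Module.End.mul_apply, triangularOp_apply, LinearMap.smul_apply, Prod.smul_fst,
          if_true, hjk, if_false, zero_mul, add_zero, one_mul, smul_mul_assoc, mul_smul_comm, h,
          hd, mul_add]
        match_scalars
        · ring
        · linear_combination -h1
      · subst hjk
        simp only [Module.End.mul_apply, triangularOp_apply, LinearMap.smul_apply, Prod.smul_fst,
          if_true, hik, if_false, zero_mul, add_zero, one_mul, smul_mul_assoc, mul_smul_comm, h,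
          hd, mul_add]
        module
      · simp only [Module.End.mul_apply, triangularOp_apply, LinearMap.smul_apply, Prod.smul_fst,
          hik, hjk, if_false, zero_mul, add_zero, smul_mul_assoc, mul_smul_comm, h]
        module
    · simp [h])

theorem skewDerivHom_snd (k : Fin n) (x : QuantumSym q) :
    (skewDerivHom hd hi k x (0, 1)).2 = x := by
  have h : LinearMap.snd ℂ _ _ ∘ₗ LinearMap.applyₗ (0, 1) ∘ₗ (skewDerivHom hd hi k).toLinearMap =
      LinearMap.id := by
    refine linearMap_ext (by simp) (fun i x hx => ?_)
    simpa [skewDerivHom] using congrArg (gen q i * ·) hx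
  exact LinearMap.congr_fun h x

/-- The skew partial derivative along the `k`-th generator, the linear map `∂` with
`∂ (v_j x) = δ_{jk} x + q_{jk} v_j ∂ x`. -/
def skewDeriv (k : Fin n) : QuantumSym q →ₗ[ℂ] QuantumSym q :=
  LinearMap.fst ℂ _ _ ∘ₗ LinearMap.applyₗ (0, 1) ∘ₗ (skewDerivHom hd hi k).toLinearMap

@[simp] theorem skewDeriv_one (k : Fin n) : skewDeriv hd hi k 1 = 0 := by
  simp [skewDeriv]

theorem skewDeriv_gen_mul (j k : Fin n) (x : QuantumSym q) :
    skewDeriv hd hi k (gen q j * x) =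
      (if j = k then x else 0) + q j k • (gen q j * skewDeriv hd hi k x) := by
  have h := skewDerivHom_snd hd hi k x
  simp only [skewDeriv, LinearMap.comp_apply, AlgHom.toLinearMap_apply, map_mul,
    LinearMap.applyₗ_apply_apply, Module.End.mul_apply, LinearMap.fst_apply]
  nth_rw 1 [skewDerivHom]
  simp [h, add_comm]

/-- A relation of degree two between the generators is a twisted antisymmetric tensor. -/
theorem antisymm_of_sum_eq_zero (hd : ∀ i, q i i = 1) (hi : ∀ i j, q i j * q j i = 1)
    (C : Fin n → Fin n → ℂ)
    (hC : ∑ k, ∑ l, C k l • (gen q k * gen q l) = 0) (m p : Fin n) :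
    C p m = - q m p * C m p := by
  have hg : ∀ j k, skewDeriv hd hi k (gen q j) = if j = k then 1 else 0 := fun j k => by
    simpa using skewDeriv_gen_mul hd hi j k 1
  -- Two partial derivatives followed by the augmentation extract coefficients: the vanishing sum
  -- becomes C_mp + q_pm C_pm = 0.
  have h2 : ∀ k l, augmentation q (skewDeriv hd hi p (skewDeriv hd hi m (gen q k * gen q l))) =
      (if k = m then (if l = p then 1 else 0) else 0) +
        q k m * (if l = m then (if k = p then 1 else 0) else 0) := fun k l => by
    simp only [skewDeriv_gen_mul, hg, mul_ite, mul_one, mul_zero, smul_ite, smul_zero, map_add,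
      apply_ite (skewDeriv hd hi p), map_zero, map_smul, apply_ite (augmentation q), map_one,
      smul_eq_mul]
  have h1 := congrArg (fun x => augmentation q (skewDeriv hd hi p (skewDeriv hd hi m x))) hC
  simp only [map_sum, map_smul, h2, smul_eq_mul, mul_add, Finset.sum_add_distrib, map_zero,
    mul_ite, mul_one, mul_zero, Finset.sum_ite_irrel, Finset.sum_const_zero, Finset.sum_ite_eq',
    Finset.mem_univ, if_true] at h1
  have h3 := hi m p
  linear_combination q m p * h1 - C p m * h3

end QuantumSym

end

/-! ### Skew group algebras -/

noncomputable section

/-- The skew group algebra `A ⋊ G` of a `ℂ`-algebra, with its ring and algebra structures. -/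
def SkewRing (A G : Type*) [Ring A] : Type _ := SkewMonoidAlgebra A G

namespace SkewRing

variable {A B G : Type*} [Ring A] [Algebra ℂ A] [Ring B] [Algebra ℂ B] [Group G]
  [MulSemiringAction G A] [SMulCommClass G ℂ A]

instance : Ring (SkewRing A G) := inferInstanceAs (Ring (SkewMonoidAlgebra A G))

instance : Algebra ℂ (SkewRing A G) := inferInstanceAs (Algebra ℂ (SkewMonoidAlgebra A G))

/-- The element `a g` of `A ⋊ G`. -/
def single (g : G) : A →ₗ[ℂ] SkewRing A G := SkewMonoidAlgebra.lsingle ℂ g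

/-- The coefficient of `g`. -/
def coeff (g : G) : SkewRing A G →ₗ[ℂ] A where
  toFun x := SkewMonoidAlgebra.coeff x g
  map_add' x y := DFunLike.congr_fun (SkewMonoidAlgebra.coeff_add x y) g
  map_smul' z x := DFunLike.congr_fun (SkewMonoidAlgebra.coeff_smul z x) g

@[ext] theorem ext {x y : SkewRing A G} (h : ∀ g, coeff g x = coeff g y) : x = y :=
  SkewMonoidAlgebra.ext h

theorem coeff_single [DecidableEq G] (g k : G) (a : A) :
    coeff k (single g a) = if g = k then a else 0 :=
  SkewMonoidAlgebra.coeff_single_apply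

theorem eq_sum_single (x : SkewRing A G) :
    ∃ s : Finset G, x = ∑ g ∈ s, single g (coeff g x) := by
  let y : SkewMonoidAlgebra A G := x
  have h := SkewMonoidAlgebra.sum_single y
  rw [SkewMonoidAlgebra.sum_def'] at h
  exact ⟨y.support, h.symm⟩

theorem mem_of_single_mem (P : Submodule ℂ (SkewRing A G)) (hP : ∀ g a, single g a ∈ P)
    (x : SkewRing A G) : x ∈ P := by
  obtain ⟨s, hs⟩ := eq_sum_single x
  rw [hs]
  exact P.sum_mem fun g _ => hP _ _

theorem linearMap_ext {N : Type*} [AddCommGroup N] [Module ℂ N] {f f' : SkewRing A G →ₗ[ℂ] N}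
    (h : ∀ g a, f (single g a) = f' (single g a)) : f = f' :=
  LinearMap.ext fun x => mem_of_single_mem (LinearMap.eqLocus f f') h x

section mapCoeff

variable [MulSemiringAction G B] [SMulCommClass G ℂ B]

/-- The linear map applying a linear map to all coefficients. -/
def mapCoeff (L : A →ₗ[ℂ] B) : SkewRing A G →ₗ[ℂ] SkewRing B G :=
  (SkewMonoidAlgebra.coeffLinearEquiv (S := ℂ)).symm.toLinearMap ∘ₗ
    Finsupp.mapRange.linearMap L ∘ₗ (SkewMonoidAlgebra.coeffLinearEquiv (S := ℂ)).toLinearMap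

@[simp] theorem coeff_mapCoeff (L : A →ₗ[ℂ] B) (x : SkewRing A G) (g : G) :
    coeff g (mapCoeff L x) = L (coeff g x) := rfl

@[simp] theorem mapCoeff_single (L : A →ₗ[ℂ] B) (g : G) (a : A) :
    mapCoeff L (single g a) = single g (L a) := by
  classical
  ext k
  rw [coeff_mapCoeff, coeff_single, coeff_single, apply_ite L, map_zero]

end mapCoeff

theorem single_mul_single (g k : G) (a b : A) :
    single g a * single k b = single (g * k) (a * g • b) :=
  SkewMonoidAlgebra.single_mul_single

theorem single_one_mul_single (g : G) (a b : A) :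
    single 1 a * single g b = single g (a * b) := by
  rw [single_mul_single, one_mul, one_smul]

theorem coeff_single_one_mul (g : G) (a : A) (x : SkewRing A G) :
    coeff g (single 1 a * x) = a * coeff g x :=
  SkewMonoidAlgebra.coeff_single_one_mul x a g

/-- The elements of `G` in `A ⋊ G`. -/
def grp (A : Type*) {G : Type*} [Ring A] [Algebra ℂ A] [Group G] [MulSemiringAction G A]
    [SMulCommClass G ℂ A] : G →* SkewRing A G where
  toFun g := single g 1
  map_one' := rfl
  map_mul' g k := by rw [single_mul_single, smul_one, mul_one]

theorem grp_apply (g : G) : grp A g = single g 1 := rfl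

theorem single_one_mul_grp (g : G) (a : A) : single 1 a * grp A g = single g a := by
  rw [grp_apply, single_one_mul_single, mul_one]

theorem grp_mul_single_one (g : G) (a : A) : grp A g * single 1 a = single g (g • a) := by
  rw [grp_apply, single_mul_single, one_mul, mul_one]

/-- The algebra homomorphism defined by compatible homomorphisms on `A` and on `G`. -/
def lift (f : A →ₐ[ℂ] B) (u : G →* B) (h : ∀ g a, f (g • a) * u g = u g * f a) :
    SkewRing A G →ₐ[ℂ] B :=
  SkewMonoidAlgebra.liftNCAlgHom f u fun {a g} => h g a

theorem lift_single (f : A →ₐ[ℂ] B) (u : G →* B) (h : ∀ g a, f (g • a) * u g = u g * f a)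
    (g : G) (a : A) : lift f u h (single g a) = f a * u g :=
  SkewMonoidAlgebra.liftNC_single _ _ _ _

end SkewRing

end

/-! ### The cover ℂ⟨v_1, …, v_n⟩[t] ⋊ G and its grading -/

noncomputable section

/-- The algebra `ℂ⟨v_1, …, v_n⟩[t] ⋊ G`. -/
abbrev Cover (n : ℕ) (G : Type*) : Type _ := SkewRing (FreePoly n) G

/-- The actions of `G` on `S_q(V)` and on `ℂ⟨v_1, …, v_n⟩[t]` are given on the generators by the
same matrices, and `q` is a multiplicatively antisymmetric matrix. -/
structure CompatibleActions {n : ℕ} {G : Type*} [Group G] (q : Fin n → Fin n → ℂ)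
    (M : G → Fin n → Fin n → ℂ) [MulSemiringAction G (QuantumSym q)]
    [MulSemiringAction G (FreePoly n)] : Prop where
  q_diag : ∀ i, q i i = 1
  q_inv : ∀ i j, q i j * q j i = 1
  smul_gen : ∀ g i, g • SkewCommAlgebra.gen q i = ∑ k, M g k i • SkewCommAlgebra.gen q k
  smul_var : ∀ g i, g • (FreePoly.var i : FreePoly n) = ∑ k, M g k i • FreePoly.var k
  smul_X : ∀ g : G, g • (Polynomial.X : FreePoly n) = Polynomial.X

variable {n : ℕ} {G : Type*} [Group G] {q : Fin n → Fin n → ℂ} {M : G → Fin n → Fin n → ℂ}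

namespace Cover

variable [MulSemiringAction G (FreePoly n)] [SMulCommClass G ℂ (FreePoly n)]

/-- The generator `v_i`. -/
def var (G : Type*) [Group G] [MulSemiringAction G (FreePoly n)]
    [SMulCommClass G ℂ (FreePoly n)] (i : Fin n) : Cover n G := SkewRing.single 1 (FreePoly.var i)

/-- The central parameter. -/
def t (n : ℕ) (G : Type*) [Group G] [MulSemiringAction G (FreePoly n)]
    [SMulCommClass G ℂ (FreePoly n)] : Cover n G := SkewRing.single 1 Polynomial.X

/-- The group elements. -/
abbrev grp (n : ℕ) {G : Type*} [Group G] [MulSemiringAction G (FreePoly n)]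
    [SMulCommClass G ℂ (FreePoly n)] : G →* Cover n G :=
  SkewRing.grp (FreePoly n)

@[elab_as_elim]
theorem induction {p : Cover n G → Prop} (y : Cover n G) (add : ∀ a b, p a → p b → p (a + b))
    (smul : ∀ (z : ℂ) a, p a → p (z • a)) (grp : ∀ g, p (grp n g))
    (var : ∀ i a, p a → p (var G i * a)) (t : ∀ a, p a → p (t n G * a)) : p y := by
  let P : Submodule ℂ (Cover n G) :=
    { carrier := {y | p y}
      add_mem' := fun ha hb => add _ _ ha hb
      zero_mem' := by simpa using smul 0 _ (grp 1)
      smul_mem' := fun z a ha => smul z a ha }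
  refine SkewRing.mem_of_single_mem P (fun g a => ?_) y
  have h : P.comap (SkewRing.single g) = ⊤ :=
    FreePoly.submodule_eq_top _ (grp g)
      (fun i x hx => by
        have := var i _ hx
        rwa [Cover.var, SkewRing.single_one_mul_single] at this)
      (fun x hx => by
        have := t _ hx
        rwa [Cover.t, SkewRing.single_one_mul_single] at this)
  have ha : a ∈ P.comap (SkewRing.single g) := by rw [h]; trivial
  exact ha

/-- On each group coefficient t is the polynomial variable, which only shifts coefficients. -/
theorem t_mul_cancel {y : Cover n G} (hy : t n G * y = 0) : y = 0 := by
  ext1 g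
  have h := congrArg (SkewRing.coeff g) hy
  rw [t, SkewRing.coeff_single_one_mul, map_zero] at h
  rw [map_zero]
  ext1 k
  have := congrArg (fun p => Polynomial.coeff p (k + 1)) h
  simpa only [Polynomial.coeff_X_mul, Polynomial.coeff_zero] using this

/-- The skew derivation along the `k`-th generator with twist `s`, applied to all coefficients. -/
def skewDeriv (G : Type*) [Group G] [MulSemiringAction G (FreePoly n)]
    [SMulCommClass G ℂ (FreePoly n)] (s : Fin n → ℂ) (k : Fin n) : Cover n G →ₗ[ℂ] Cover n G :=
  SkewRing.mapCoeff (FreePoly.skewDeriv s k)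

@[simp] theorem skewDeriv_grp (s : Fin n → ℂ) (k : Fin n) (g : G) :
    skewDeriv G s k (grp n g) = 0 := by
  simp [skewDeriv, SkewRing.grp_apply]

/-- Two twists matter later: s_j = q_jk lifts the skew partial derivatives of S_q(V), and s = 0
strips a leading v_k. -/
theorem skewDeriv_var_mul (s : Fin n → ℂ) (j k : Fin n) (y : Cover n G) :
    skewDeriv G s k (var G j * y) =
      (if j = k then y else 0) + s j • (var G j * skewDeriv G s k y) := by
  ext1 g
  rw [skewDeriv, var, SkewRing.coeff_mapCoeff, SkewRing.coeff_single_one_mul,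
    FreePoly.skewDeriv_var_mul, map_add, map_smul, SkewRing.coeff_single_one_mul,
    SkewRing.coeff_mapCoeff, apply_ite (SkewRing.coeff g), map_zero]

theorem skewDeriv_t_mul (s : Fin n → ℂ) (k : Fin n) (y : Cover n G) :
    skewDeriv G s k (t n G * y) = t n G * skewDeriv G s k y := by
  ext1 g
  rw [skewDeriv, t, SkewRing.coeff_mapCoeff, SkewRing.coeff_single_one_mul,
    FreePoly.skewDeriv_X_mul, SkewRing.coeff_single_one_mul, SkewRing.coeff_mapCoeff]

variable [MulSemiringAction G (QuantumSym q)] (h : CompatibleActions q M)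
include h

theorem t_mul_comm (y : Cover n G) : t n G * y = y * t n G := by
  have : LinearMap.mulLeft ℂ (t n G) = LinearMap.mulRight ℂ (t n G) :=
    SkewRing.linearMap_ext fun g a => by
      simp only [LinearMap.mulLeft_apply, LinearMap.mulRight_apply, t,
        SkewRing.single_mul_single, one_mul, mul_one, one_smul, h.smul_X, Polynomial.X_mul]
  exact LinearMap.congr_fun this y

theorem grp_mul_var (g : G) (i : Fin n) :
    grp n g * var G i = ∑ k, M g k i • (var G k * grp n g) := by
  simp_rw [var, SkewRing.single_one_mul_grp, SkewRing.grp_mul_single_one, h.smul_var, map_sum,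
    map_smul]

/-- The algebra homomorphism with prescribed values on the generators. -/
def lift {A : Type*} [Ring A] [Algebra ℂ A] (x : Fin n → A) (s : A) (u : G →* A)
    (hxs : ∀ i, x i * s = s * x i) (hus : ∀ g, u g * s = s * u g)
    (hux : ∀ g i, u g * x i = ∑ k, M g k i • (x k * u g)) : Cover n G →ₐ[ℂ] A :=
  SkewRing.lift (FreePoly.lift x s hxs) u fun g y => by
    set f := FreePoly.lift x s hxs
    have : LinearMap.mulRight ℂ (u g) ∘ₗ f.toLinearMap ∘ₗ DistribSMul.toLinearMap ℂ _ g =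
        LinearMap.mulLeft ℂ (u g) ∘ₗ f.toLinearMap := by
      refine FreePoly.linearMap_ext (by simp) (fun i y hy => ?_) (fun y hy => ?_)
      · replace hy : f (g • y) * u g = u g * f y := hy
        change f (g • (FreePoly.var i * y)) * u g = u g * f (FreePoly.var i * y)
        rw [smul_mul', map_mul, map_mul, mul_assoc, hy, ← mul_assoc, ← mul_assoc, h.smul_var]
        congr 1
        simp [f, hux, Finset.sum_mul]
      · replace hy : f (g • y) * u g = u g * f y := hy
        change f (g • (Polynomial.X * y)) * u g = u g * f (Polynomial.X * y)
        rw [smul_mul', map_mul, map_mul, mul_assoc, hy, ← mul_assoc, ← mul_assoc, h.smul_X]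
        congr 1
        simp [f, hus]
    exact LinearMap.congr_fun this y

section lift

variable {A : Type*} [Ring A] [Algebra ℂ A] (x : Fin n → A) (s : A) (u : G →* A)
    (hxs : ∀ i, x i * s = s * x i) (hus : ∀ g, u g * s = s * u g)
    (hux : ∀ g i, u g * x i = ∑ k, M g k i • (x k * u g))

@[simp] theorem lift_var (i : Fin n) : lift h x s u hxs hus hux (var G i) = x i := by
  simp [var, lift, SkewRing.lift_single]

@[simp] theorem lift_t : lift h x s u hxs hus hux (t n G) = s := by
  simp [t, lift, SkewRing.lift_single]

@[simp] theorem lift_grp (g : G) : lift h x s u hxs hus hux (grp n g) = u g := by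
  simp [SkewRing.grp_apply, lift, SkewRing.lift_single]

end lift

/-- The coaction defining the grading with all `v_i` of degree `1`, `t` of degree `2` and the
elements of `G` of degree `0`. -/
def coaction : Cover n G →ₐ[ℂ] AddMonoidAlgebra (Cover n G) ℤ :=
  lift h (fun i => AddMonoidAlgebra.single (1 : ℤ) (var G i))
    (AddMonoidAlgebra.single (2 : ℤ) (t n G))
    ((AddMonoidAlgebra.singleZeroRingHom :
      Cover n G →+* AddMonoidAlgebra (Cover n G) ℤ).toMonoidHom.comp (grp n))
    (fun i => by
      rw [AddMonoidAlgebra.single_mul_single, AddMonoidAlgebra.single_mul_single, t_mul_comm h,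
        add_comm])
    (fun g => by
      change AddMonoidAlgebra.single 0 (grp n g) * _ = _ * AddMonoidAlgebra.single 0 (grp n g)
      rw [AddMonoidAlgebra.single_mul_single, AddMonoidAlgebra.single_mul_single, t_mul_comm h,
        add_comm])
    (fun g i => by
      change AddMonoidAlgebra.single 0 (grp n g) * _ =
        ∑ k, M g k i • (_ * AddMonoidAlgebra.single 0 (grp n g))
      simp_rw [AddMonoidAlgebra.single_mul_single, grp_mul_var h, zero_add, add_zero]
      rw [← AddMonoidAlgebra.lsingle_apply (R := ℂ), map_sum]
      simp_rw [map_smul, AddMonoidAlgebra.lsingle_apply])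

/-- The projection onto the homogeneous component of degree `d`. -/
def proj (d : ℤ) : Cover n G →ₗ[ℂ] Cover n G where
  toFun y := (coaction h y).coeff d
  map_add' y z := by simp
  map_smul' c y := by simp

theorem proj_apply (d : ℤ) (y : Cover n G) : proj h d y = (coaction h y).coeff d := rfl

theorem coaction_var (i : Fin n) :
    coaction h (var G i) = AddMonoidAlgebra.single (1 : ℤ) (var G i) := lift_var ..

theorem coaction_t : coaction h (t n G) = AddMonoidAlgebra.single (2 : ℤ) (t n G) := lift_t ..

theorem coaction_grp (g : G) :
    coaction h (grp n g) = AddMonoidAlgebra.single (0 : ℤ) (grp n g) := lift_grp ..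

theorem proj_var_mul (d : ℤ) (i : Fin n) (y : Cover n G) :
    proj h d (var G i * y) = var G i * proj h (d - 1) y := by
  rw [proj_apply, map_mul, coaction_var, AddMonoidAlgebra.coeff_single_mul_apply, neg_add_eq_sub,
    proj_apply]

theorem proj_t_mul (d : ℤ) (y : Cover n G) :
    proj h d (t n G * y) = t n G * proj h (d - 2) y := by
  rw [proj_apply, map_mul, coaction_t, AddMonoidAlgebra.coeff_single_mul_apply, neg_add_eq_sub,
    proj_apply]

theorem proj_grp_mul (d : ℤ) (g : G) (y : Cover n G) :
    proj h d (grp n g * y) = grp n g * proj h d y := by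
  rw [proj_apply, map_mul, coaction_grp, AddMonoidAlgebra.coeff_single_mul_apply, neg_add_eq_sub,
    proj_apply, sub_zero]

theorem proj_grp (d : ℤ) (g : G) : proj h d (grp n g) = if d = 0 then grp n g else 0 := by
  rw [proj_apply, coaction_grp, AddMonoidAlgebra.coeff_single, Finsupp.single_apply]
  simp only [eq_comm]

theorem proj_proj (d e : ℤ) (y : Cover n G) :
    proj h e (proj h d y) = if e = d then proj h d y else 0 := by
  induction y using Cover.induction generalizing d e with
  | add a b ha hb => simp only [map_add, ha, hb]; split_ifs <;> simp
  | smul z a ha => simp only [map_smul, ha]; split_ifs <;> simp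
  | grp g => rw [proj_grp]; split_ifs <;> simp_all [proj_grp]
  | var i a ha => simp only [proj_var_mul, ha, sub_left_inj]; split_ifs <;> simp
  | t a ha => simp only [proj_t_mul, ha, sub_left_inj]; split_ifs <;> simp

theorem proj_of_neg {d : ℤ} (hd : d < 0) (y : Cover n G) : proj h d y = 0 := by
  induction y using Cover.induction generalizing d with
  | add a b ha hb => simp [ha hd, hb hd]
  | smul z a ha => simp [ha hd]
  | grp g => rw [proj_grp, if_neg hd.ne]
  | var i a ha => rw [proj_var_mul, ha (by omega), mul_zero]
  | t a ha => rw [proj_t_mul, ha (by omega), mul_zero]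

theorem mem_of_proj_mem (P : AddSubmonoid (Cover n G)) {y : Cover n G} (hy : ∀ d, proj h d y ∈ P) :
    y ∈ P := by
  -- `F` forgets the degree and is a left inverse of the coaction, so y is the finite sum of its
  -- projections.
  let F : AddMonoidAlgebra (Cover n G) ℤ →ₐ[ℂ] Cover n G :=
    AddMonoidAlgebra.liftNCAlgHom (AlgHom.id ℂ (Cover n G)) (1 : Multiplicative ℤ →* Cover n G)
      (fun _ _ => Commute.one_right _)
  have hF : ∀ d x, F (AddMonoidAlgebra.single d x) = x := fun d x =>
    (AddMonoidAlgebra.liftNC_single _ _ _ _).trans (mul_one x)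
  have hy' : F (coaction h y) = y := by
    clear hy
    induction y using Cover.induction with
    | add a b ha hb => rw [map_add, map_add, ha, hb]
    | smul z a ha => rw [map_smul, map_smul, ha]
    | grp g => rw [coaction_grp, hF]
    | var i a ha => rw [map_mul, map_mul, ha, coaction_var, hF]
    | t a ha => rw [map_mul, map_mul, ha, coaction_t, hF]
  have hs := AddMonoidAlgebra.sum_coeff_single (coaction h y)
  rw [← hy', ← hs, Finsupp.sum, map_sum]
  refine P.sum_mem fun d _ => ?_
  rw [hF]
  exact hy d

/-- The homogeneous component of degree `d`. -/
def piece (d : ℤ) : Submodule ℂ (Cover n G) := LinearMap.eqLocus (proj h d) LinearMap.id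

theorem mem_piece {d : ℤ} {y : Cover n G} : y ∈ piece h d ↔ proj h d y = y := Iff.rfl

theorem proj_mem_piece (d : ℤ) (y : Cover n G) : proj h d y ∈ piece h d := by
  simp [mem_piece, proj_proj]

theorem var_mul_mem_piece {d : ℤ} {y : Cover n G} (hy : y ∈ piece h (d - 1)) (i : Fin n) :
    var G i * y ∈ piece h d := by
  rw [mem_piece, proj_var_mul, (mem_piece h).1 hy]

theorem t_mul_mem_piece {d : ℤ} {y : Cover n G} (hy : y ∈ piece h (d - 2)) :
    t n G * y ∈ piece h d := by
  rw [mem_piece, proj_t_mul, (mem_piece h).1 hy]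

theorem grp_mul_mem_piece {d : ℤ} {y : Cover n G} (hy : y ∈ piece h d) (g : G) :
    grp n g * y ∈ piece h d := by
  rw [mem_piece, proj_grp_mul, (mem_piece h).1 hy]

theorem grp_mem_piece (g : G) : grp n g ∈ piece h 0 := by
  simp [mem_piece, proj_grp]

theorem eq_zero_of_mem_piece {d : ℤ} (hd : d < 0) {y : Cover n G} (hy : y ∈ piece h d) :
    y = 0 := by
  rw [← (mem_piece h).1 hy, proj_of_neg h hd]

/-- Projections commute with left multiplication by generators up to a shift, so components can be
built letter by letter. Keeping y homogeneous in the hypotheses lets negative degrees be discarded.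
-/
theorem piece_le (P : ℤ → Submodule ℂ (Cover n G)) (hg : ∀ g, grp n g ∈ P 0)
    (hv : ∀ d i, ∀ y ∈ piece h d, y ∈ P d → var G i * y ∈ P (d + 1))
    (ht : ∀ d, ∀ y ∈ piece h d, y ∈ P d → t n G * y ∈ P (d + 2)) (d : ℤ) : piece h d ≤ P d := by
  suffices H : ∀ y, proj h d y ∈ P d from fun y hy => by
    rw [← (mem_piece h).1 hy]
    exact H y
  intro y
  induction y using Cover.induction generalizing d with
  | add a b ha hb => rw [map_add]; exact (P d).add_mem (ha d) (hb d)
  | smul z a ha => rw [map_smul]; exact (P d).smul_mem z (ha d)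
  | grp g =>
    rw [proj_grp]
    split_ifs with hd
    · exact hd ▸ hg g
    · exact zero_mem _
  | var i a ha =>
    rw [proj_var_mul]
    simpa using hv (d - 1) i _ (proj_mem_piece h _ _) (ha (d - 1))
  | t a ha =>
    rw [proj_t_mul]
    simpa using ht (d - 2) _ (proj_mem_piece h _ _) (ha (d - 2))

theorem skewDeriv_proj (s : Fin n → ℂ) (k : Fin n) (d : ℤ) (y : Cover n G) :
    skewDeriv G s k (proj h d y) = proj h (d - 1) (skewDeriv G s k y) := by
  induction y using Cover.induction generalizing d with
  | add a b ha hb => simp only [map_add, ha, hb]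
  | smul z a ha => simp only [map_smul, ha]
  | grp g => rw [proj_grp]; split_ifs <;> simp
  | var i a ha =>
    rw [proj_var_mul, skewDeriv_var_mul, skewDeriv_var_mul, ha, map_add, map_smul, proj_var_mul]
    split_ifs <;> simp
  | t a ha =>
    rw [proj_t_mul, skewDeriv_t_mul, skewDeriv_t_mul, ha, proj_t_mul, sub_right_comm]

theorem skewDeriv_mem_piece (s : Fin n → ℂ) (k : Fin n) {d : ℤ} {y : Cover n G}
    (hy : y ∈ piece h d) : skewDeriv G s k y ∈ piece h (d - 1) := by
  rw [mem_piece, ← skewDeriv_proj, (mem_piece h).1 hy]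

end Cover

end

/-! ### The graded algebra S_q(V) ⋊ G -/

noncomputable section

/-- The algebra `S_q(V) ⋊ G`. -/
abbrev QuantumSkew {n : ℕ} (q : Fin n → Fin n → ℂ) (G : Type*) : Type _ :=
  SkewRing (QuantumSym q) G

variable {n : ℕ} {G : Type*} [Group G] {q : Fin n → Fin n → ℂ} {M : G → Fin n → Fin n → ℂ}

namespace QuantumSym

theorem piece_of_neg {d : ℤ} (hd : d < 0) : QuantumSym.piece q d = ⊥ := by
  cases d with
  | ofNat m => exact absurd hd (by simp)
  | negSucc m => rfl

theorem gen_mul_mem_piece (d : ℤ) (i : Fin n) {a : QuantumSym q} (ha : a ∈ QuantumSym.piece q d) :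
    SkewCommAlgebra.gen q i * a ∈ QuantumSym.piece q (d + 1) := by
  cases d with
  | ofNat m =>
    change _ ∈ (Submodule.span ℂ (Set.range (SkewCommAlgebra.gen q))) ^ (m + 1)
    rw [pow_succ']
    exact Submodule.mul_mem_mul (Submodule.subset_span ⟨i, rfl⟩) ha
  | negSucc m =>
    rw [(Submodule.mem_bot ℂ).1 ha, mul_zero]
    exact zero_mem _

theorem one_mem_piece : (1 : QuantumSym q) ∈ QuantumSym.piece q 0 := by
  change _ ∈ (Submodule.span ℂ (Set.range (SkewCommAlgebra.gen q))) ^ 0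
  rw [pow_zero]
  exact Submodule.one_le.1 le_rfl

end QuantumSym

namespace QuantumSkew

variable [MulSemiringAction G (QuantumSym q)] [SMulCommClass G ℂ (QuantumSym q)]

/-- The generator `v_i`. -/
def gen (q : Fin n → Fin n → ℂ) (G : Type*) [Group G] [MulSemiringAction G (QuantumSym q)]
    [SMulCommClass G ℂ (QuantumSym q)] (i : Fin n) : QuantumSkew q G :=
  SkewRing.single 1 (SkewCommAlgebra.gen q i)

/-- The group elements. -/
abbrev grp (q : Fin n → Fin n → ℂ) {G : Type*} [Group G] [MulSemiringAction G (QuantumSym q)]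
    [SMulCommClass G ℂ (QuantumSym q)] : G →* QuantumSkew q G := SkewRing.grp (QuantumSym q)

theorem gen_mul_gen (i j : Fin n) : gen q G i * gen q G j = q i j • (gen q G j * gen q G i) := by
  rw [gen, gen, SkewRing.single_one_mul_single, SkewRing.single_one_mul_single,
    SkewCommAlgebra.gen_mul_gen, map_smul]

/-- The homogeneous component of degree `d`. -/
def piece (q : Fin n → Fin n → ℂ) (G : Type*) [Group G] [MulSemiringAction G (QuantumSym q)]
    [SMulCommClass G ℂ (QuantumSym q)] (d : ℤ) : Submodule ℂ (QuantumSkew q G) :=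
  ⨅ g, (QuantumSym.piece q d).comap (SkewRing.coeff g)

theorem mem_piece {d : ℤ} {x : QuantumSkew q G} :
    x ∈ piece q G d ↔ ∀ g, SkewRing.coeff g x ∈ QuantumSym.piece q d := by
  simp [piece]

theorem eq_zero_of_mem_piece {d : ℤ} (hd : d < 0) {x : QuantumSkew q G} (hx : x ∈ piece q G d) :
    x = 0 := by
  ext1 g
  have := mem_piece.1 hx g
  rw [QuantumSym.piece_of_neg hd] at this
  rw [(Submodule.mem_bot ℂ).1 this, map_zero]

theorem single_mem_piece {d : ℤ} {a : QuantumSym q} (ha : a ∈ QuantumSym.piece q d) (g : G) :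
    SkewRing.single g a ∈ piece q G d := by
  classical
  refine mem_piece.2 fun k => ?_
  rw [SkewRing.coeff_single]
  split_ifs
  · exact ha
  · exact zero_mem _

theorem grp_mem_piece (g : G) : grp q g ∈ piece q G 0 :=
  single_mem_piece QuantumSym.one_mem_piece g

theorem one_mem_piece : (1 : QuantumSkew q G) ∈ piece q G 0 := by
  rw [← map_one (grp q)]
  exact grp_mem_piece 1

theorem gen_mul_mem_piece (d : ℤ) (i : Fin n) {x : QuantumSkew q G} (hx : x ∈ piece q G d) :
    gen q G i * x ∈ piece q G (d + 1) := by
  refine mem_piece.2 fun k => ?_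
  rw [gen, SkewRing.coeff_single_one_mul]
  exact QuantumSym.gen_mul_mem_piece d i (mem_piece.1 hx k)

theorem gen_mem_piece (i : Fin n) : gen q G i ∈ piece q G 1 := by
  have := gen_mul_mem_piece (G := G) (q := q) 0 i one_mem_piece
  rwa [mul_one, zero_add] at this

/-- An inductive description of the homogeneous components. -/
theorem piece_le (P : ℤ → Submodule ℂ (QuantumSkew q G)) (hg : ∀ g, grp q g ∈ P 0)
    (hv : ∀ d i, ∀ x ∈ P d, gen q G i * x ∈ P (d + 1)) (d : ℤ) : piece q G d ≤ P d := by
  intro x hx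
  obtain ⟨s, hs⟩ := SkewRing.eq_sum_single x
  rw [hs]
  refine sum_mem fun g _ => ?_
  have ha := mem_piece.1 hx g
  generalize SkewRing.coeff g x = a at ha
  cases d with
  | negSucc m =>
    rw [(Submodule.mem_bot ℂ).1 ha, map_zero]
    exact zero_mem _
  | ofNat m =>
    change a ∈ (Submodule.span ℂ (Set.range (SkewCommAlgebra.gen q))) ^ m at ha
    suffices (Submodule.span ℂ (Set.range (SkewCommAlgebra.gen q))) ^ m ≤
        (P m).comap (SkewRing.single g) from this ha
    clear ha hs hx
    induction m with
    | zero =>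
      rw [pow_zero, Submodule.one_le]
      exact hg g
    | succ m ih =>
      rw [pow_succ', Submodule.mul_le]
      intro b hb a ha
      have ha' := ih ha
      rw [Submodule.mem_comap] at ha' ⊢
      rw [← SkewRing.single_one_mul_single]
      induction hb using Submodule.span_induction with
      | mem b hb =>
        obtain ⟨i, rfl⟩ := hb
        exact hv m i _ ha'
      | zero => rw [map_zero, zero_mul]; exact zero_mem _
      | add b c _ _ hb hc => rw [map_add, add_mul]; exact add_mem hb hc
      | smul z b _ hb => rw [map_smul, smul_mul_assoc]; exact Submodule.smul_mem _ z hb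

section

variable (h : ∀ (g : G) i,
  g • SkewCommAlgebra.gen q i = ∑ k, M g k i • SkewCommAlgebra.gen q k)
include h

theorem grp_mul_gen (g : G) (i : Fin n) :
    grp q g * gen q G i = ∑ k, M g k i • (gen q G k * grp q g) := by
  simp_rw [gen, SkewRing.single_one_mul_grp, SkewRing.grp_mul_single_one, h, map_sum,
    map_smul]

end

/-- The skew partial derivative along the `k`-th generator, applied to all coefficients. -/
def skewDeriv (G : Type*) [Group G] [MulSemiringAction G (QuantumSym q)]
    [SMulCommClass G ℂ (QuantumSym q)] (hd : ∀ i, q i i = 1) (hi : ∀ i j, q i j * q j i = 1)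
    (k : Fin n) : QuantumSkew q G →ₗ[ℂ] QuantumSkew q G :=
  SkewRing.mapCoeff (QuantumSym.skewDeriv hd hi k)

section

variable (hd : ∀ i, q i i = 1) (hi : ∀ i j, q i j * q j i = 1)

@[simp] theorem skewDeriv_grp (k : Fin n) (g : G) : skewDeriv G hd hi k (grp q g) = 0 := by
  simp [skewDeriv, SkewRing.grp_apply]

theorem skewDeriv_gen_mul (j k : Fin n) (x : QuantumSkew q G) :
    skewDeriv G hd hi k (gen q G j * x) =
      (if j = k then x else 0) + q j k • (gen q G j * skewDeriv G hd hi k x) := by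
  ext1 g
  rw [skewDeriv, gen, SkewRing.coeff_mapCoeff, SkewRing.coeff_single_one_mul,
    QuantumSym.skewDeriv_gen_mul, map_add, map_smul, SkewRing.coeff_single_one_mul,
    SkewRing.coeff_mapCoeff, apply_ite (SkewRing.coeff g), map_zero]

end

variable [MulSemiringAction G (FreePoly n)] [SMulCommClass G ℂ (FreePoly n)]

/-- The linear map to the cover that is the identity on `G` and zero in positive degrees. -/
def constantPart : QuantumSkew q G →ₗ[ℂ] Cover n G :=
  SkewRing.mapCoeff (Algebra.linearMap ℂ (FreePoly n) ∘ₗ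
    (SkewCommAlgebra.augmentation q).toLinearMap)

@[simp] theorem constantPart_grp (g : G) : constantPart (grp q g) = Cover.grp n g := by
  simp [constantPart, SkewRing.grp_apply]

theorem constantPart_mem_piece (h : CompatibleActions q M)
    (x : QuantumSkew q G) : constantPart x ∈ Cover.piece h 0 := by
  suffices H : ∀ x : QuantumSkew q G, x ∈ (Cover.piece h 0).comap constantPart from H x
  refine SkewRing.mem_of_single_mem _ fun g a => ?_
  have : constantPart (SkewRing.single g a : QuantumSkew q G) =
      SkewCommAlgebra.augmentation q a • Cover.grp n g := by
    rw [constantPart, SkewRing.mapCoeff_single, SkewRing.grp_apply, ← map_smul]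
    congr 1
    exact Algebra.algebraMap_eq_smul_one (A := FreePoly n) (SkewCommAlgebra.augmentation q a)
  rw [Submodule.mem_comap, this]
  exact Submodule.smul_mem _ _ (Cover.grp_mem_piece h g)

end QuantumSkew

end

/-! ### Specialization at t = 0 and the Euler identity -/

noncomputable section

variable {n : ℕ} {G : Type*} [Group G] {q : Fin n → Fin n → ℂ} {M : G → Fin n → Fin n → ℂ}
  [MulSemiringAction G (QuantumSym q)] [SMulCommClass G ℂ (QuantumSym q)]
  [MulSemiringAction G (FreePoly n)] [SMulCommClass G ℂ (FreePoly n)]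

namespace Cover

variable (h : CompatibleActions q M)

theorem proj_mul_of_mem_piece {e : ℤ} {z : Cover n G} (hz : z ∈ piece h e) (d : ℤ)
    (y : Cover n G) : proj h d (z * y) = z * proj h (d - e) y := by
  let P : ℤ → Submodule ℂ (Cover n G) := fun e =>
    { carrier := {z | ∀ d y, proj h d (z * y) = z * proj h (d - e) y}
      add_mem' := fun ha hb d y => by rw [add_mul, map_add, ha, hb, add_mul]
      zero_mem' := fun d y => by simp
      smul_mem' := fun c a ha d y => by rw [smul_mul_assoc, map_smul, ha, smul_mul_assoc] }
  refine piece_le h P (fun g d y => ?_) (fun e i z _ hz d y => ?_) (fun e z _ hz d y => ?_) e hz d y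
  · rw [proj_grp_mul, sub_zero]
  · rw [mul_assoc, proj_var_mul, hz, mul_assoc, sub_sub, add_comm e]
  · rw [mul_assoc, proj_t_mul, hz, mul_assoc, sub_sub, add_comm e]

theorem mul_mem_piece {d e : ℤ} {y z : Cover n G} (hz : z ∈ piece h d) (hy : y ∈ piece h e) :
    z * y ∈ piece h (d + e) := by
  rw [mem_piece, proj_mul_of_mem_piece h hz, add_sub_cancel_left, (mem_piece h).1 hy]

theorem var_mem_piece (i : Fin n) : var G i ∈ piece h 1 := by
  have := var_mul_mem_piece h (d := 1) (grp_mem_piece h 1) i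
  rwa [map_one, mul_one] at this

theorem piece_zero_le (P : Submodule ℂ (Cover n G)) (hg : ∀ g, grp n g ∈ P) : piece h 0 ≤ P := by
  -- With no condition outside degree 0, a step by v_i or t landing in degree 0 starts in negative
  -- degree, where everything is zero.
  have := piece_le h (fun d => if d = 0 then P else ⊤) (by simpa using hg)
    (fun d i y hy _ => by
      split_ifs with hd
      · rw [eq_zero_of_mem_piece h (by omega) hy, mul_zero]; exact zero_mem _
      · trivial)
    (fun d y hy _ => by
      split_ifs with hd
      · rw [eq_zero_of_mem_piece h (by omega) hy, mul_zero]; exact zero_mem _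
      · trivial) 0
  simpa using this

theorem piece_one_le (P : Submodule ℂ (Cover n G)) (hv : ∀ i, ∀ y ∈ piece h 0, var G i * y ∈ P) :
    piece h 1 ≤ P := by
  have := piece_le h (fun d => if d = 1 then P else ⊤) (by simp)
    (fun d i y hy _ => by
      split_ifs with hd
      · obtain rfl : d = 0 := by omega
        exact hv i y hy
      · trivial)
    (fun d y hy _ => by
      split_ifs with hd
      · rw [eq_zero_of_mem_piece h (by omega) hy, mul_zero]; exact zero_mem _
      · trivial) 1
  simpa using this

/-- The homomorphism `ℂ⟨v_1, …, v_n⟩[t] ⋊ G → S_q(V) ⋊ G` with `t ↦ 0`. -/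
def specialize : Cover n G →ₐ[ℂ] QuantumSkew q G :=
  lift h (QuantumSkew.gen q G) 0 (QuantumSkew.grp q) (by simp) (by simp)
    (QuantumSkew.grp_mul_gen h.smul_gen)

@[simp] theorem specialize_var (i : Fin n) : specialize h (var G i) = QuantumSkew.gen q G i :=
  lift_var ..

@[simp] theorem specialize_t : specialize h (t n G) = 0 := lift_t ..

@[simp] theorem specialize_grp (g : G) : specialize h (grp n g) = QuantumSkew.grp q g :=
  lift_grp ..

theorem specialize_mem_piece {d : ℤ} {y : Cover n G} (hy : y ∈ piece h d) :
    specialize h y ∈ QuantumSkew.piece q G d := by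
  refine piece_le h (fun d => (QuantumSkew.piece q G d).comap (specialize h).toLinearMap)
    (fun g => ?_) (fun d i y _ hy => ?_) (fun d y _ hy => ?_) d hy
  · simpa using QuantumSkew.grp_mem_piece g
  · simpa using QuantumSkew.gen_mul_mem_piece d i hy
  · simp

theorem exists_specialize_eq {d : ℤ} {x : QuantumSkew q G} (hx : x ∈ QuantumSkew.piece q G d) :
    ∃ y ∈ piece h d, specialize h y = x := by
  refine QuantumSkew.piece_le (fun d => (piece h d).map (specialize h).toLinearMap)
    (fun g => ⟨grp n g, grp_mem_piece h g, by simp⟩) (fun d i x hx => ?_) d hx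
  obtain ⟨y, hy, rfl⟩ := hx
  exact ⟨var G i * y, var_mul_mem_piece h (by rwa [add_sub_cancel_right]) i, by simp⟩

theorem specialize_surjective : Function.Surjective (specialize h) := by
  intro x
  suffices H : x ∈ LinearMap.range (specialize h).toLinearMap from H
  refine SkewRing.mem_of_single_mem _ (fun g a => ?_) x
  suffices H : (LinearMap.range (specialize h).toLinearMap).comap (SkewRing.single g) = ⊤ from
    (Submodule.eq_top_iff'.1 H a : _)
  refine SkewCommAlgebra.submodule_eq_top _ ⟨grp n g, specialize_grp h g⟩ fun i b hb => ?_
  obtain ⟨y, hy⟩ := hb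
  refine ⟨var G i * y, ?_⟩
  replace hy : specialize h y = _ := hy
  change specialize h _ = _
  rw [map_mul, hy, specialize_var, QuantumSkew.gen, SkewRing.single_one_mul_single]

theorem specialize_skewDeriv (k : Fin n) (y : Cover n G) :
    specialize h (skewDeriv G (fun j => q j k) k y) =
      QuantumSkew.skewDeriv G h.q_diag h.q_inv k (specialize h y) := by
  induction y using Cover.induction with
  | add a b ha hb => simp only [map_add, ha, hb]
  | smul z a ha => simp only [map_smul, ha]
  | grp g => simp
  | var i a ha =>
    rw [skewDeriv_var_mul, map_add, map_smul, map_mul, map_mul, ha, specialize_var,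
      QuantumSkew.skewDeriv_gen_mul, apply_ite (specialize h), map_zero]
  | t a ha => simp [skewDeriv_t_mul]

theorem constantPart_specialize {y : Cover n G} (hy : y ∈ piece h 0) :
    QuantumSkew.constantPart (specialize h y) = y := by
  refine piece_zero_le h (LinearMap.eqLocus
    (QuantumSkew.constantPart ∘ₗ (specialize h).toLinearMap) LinearMap.id) (fun g => ?_) hy
  simp [LinearMap.mem_eqLocus]

/-- Degree 1 is spanned by the v_i z with z of degree 0. Derivations kill z, so only the Kronecker
term survives. -/
theorem sum_var_mul_skewDeriv {y : Cover n G} (hy : y ∈ piece h 1) :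
    ∑ k, var G k * skewDeriv G (fun j => q j k) k y = y := by
  let P : Submodule ℂ (Cover n G) := LinearMap.eqLocus
    (∑ k, LinearMap.mulLeft ℂ (var G k) ∘ₗ skewDeriv G (fun j => q j k) k) LinearMap.id
  have hP : ∀ y, y ∈ P ↔ ∑ k, var G k * skewDeriv G (fun j => q j k) k y = y := fun y => by
    simp [P, LinearMap.mem_eqLocus]
  refine (hP y).1 (piece_one_le h P (fun i z hz => (hP _).2 ?_) hy)
  have h0 : ∀ s k, skewDeriv G s k z = 0 := fun s k =>
    eq_zero_of_mem_piece h (by norm_num) (skewDeriv_mem_piece h s k hz)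
  simp [skewDeriv_var_mul, h0]

theorem eq_zero_of_specialize_eq_zero₀ {y : Cover n G} (hy : y ∈ piece h 0)
    (h0 : specialize h y = 0) : y = 0 := by
  rw [← constantPart_specialize h hy, h0, map_zero]

/-- The derivations reduce degree 1 to degree 0, where `constantPart` inverts the specialization.
This injectivity upgrades first order identities to exact ones. -/
theorem eq_zero_of_specialize_eq_zero₁ {y : Cover n G} (hy : y ∈ piece h 1)
    (h0 : specialize h y = 0) : y = 0 := by
  rw [← sum_var_mul_skewDeriv h hy]
  refine Finset.sum_eq_zero fun k _ => ?_
  rw [eq_zero_of_specialize_eq_zero₀ h (skewDeriv_mem_piece h _ _ hy), mul_zero]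
  rw [specialize_skewDeriv, h0, map_zero]

theorem specialize_constantPart {x : QuantumSkew q G} (hx : x ∈ QuantumSkew.piece q G 0) :
    specialize h (QuantumSkew.constantPart x) = x := by
  obtain ⟨y, hy, rfl⟩ := exists_specialize_eq h hx
  rw [constantPart_specialize h hy]

/-- The Euler identity for the skew partial derivatives. -/
theorem sum_gen_mul_specialize_skewDeriv {d : ℤ} {y : Cover n G} (hy : y ∈ piece h d) :
    ∑ k, QuantumSkew.gen q G k * specialize h (skewDeriv G (fun j => q j k) k y) =
      (d : ℂ) • specialize h y := by
  let P : ℤ → Submodule ℂ (Cover n G) := fun d => LinearMap.eqLocus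
    (∑ k, LinearMap.mulLeft ℂ (QuantumSkew.gen q G k) ∘ₗ (specialize h).toLinearMap ∘ₗ
      skewDeriv G (fun j => q j k) k) ((d : ℂ) • (specialize h).toLinearMap)
  have hP : ∀ d y, y ∈ P d ↔
      ∑ k, QuantumSkew.gen q G k * specialize h (skewDeriv G (fun j => q j k) k y) =
      (d : ℂ) • specialize h y := fun d y => by
    simp [P, LinearMap.mem_eqLocus]
  refine (hP d y).1 (piece_le h P (fun g => (hP _ _).2 ?_) (fun d i z _ hz => (hP _ _).2 ?_)
    (fun d z _ hz => (hP _ _).2 ?_) d hy)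
  · simp
  · have hz' := (hP _ _).1 hz
    -- The twist q_ik is exactly the factor for exchanging v_k and v_i, so v_i comes out in front.
    have : ∀ k, QuantumSkew.gen q G k *
        specialize h (skewDeriv G (fun j => q j k) k (var G i * z)) =
        (if i = k then QuantumSkew.gen q G i * specialize h z else 0) + QuantumSkew.gen q G i *
          (QuantumSkew.gen q G k * specialize h (skewDeriv G (fun j => q j k) k z)) := fun k => by
      rw [skewDeriv_var_mul, map_add, mul_add, map_smul, map_mul, specialize_var, mul_smul_comm,
        ← mul_assoc (QuantumSkew.gen q G i), QuantumSkew.gen_mul_gen, smul_mul_assoc, mul_assoc]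
      split_ifs with hik
      · rw [hik]
      · simp
    simp_rw [this]
    rw [Finset.sum_add_distrib, ← Finset.mul_sum, hz', map_mul, specialize_var]
    simp [add_smul, add_comm]
  · simp [skewDeriv_t_mul]

end Cover

end

/-! ### Constant cocycles and the deformed quadratic relations -/

noncomputable section

variable {n : ℕ} {G : Type*} [Group G] {q : Fin n → Fin n → ℂ} {M : G → Fin n → Fin n → ℂ}
  [MulSemiringAction G (QuantumSym q)] [SMulCommClass G ℂ (QuantumSym q)]

/-- A constant Hochschild 2-cocycle on `S_q(V) ⋊ G` that vanishes when one of its arguments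
is `1`. -/
structure ConstantCocycle {n : ℕ} (q : Fin n → Fin n → ℂ) (G : Type*) [Group G]
    [MulSemiringAction G (QuantumSym q)] [SMulCommClass G ℂ (QuantumSym q)] extends
    UnitalTwoCocycle (QuantumSkew q G) where
  constant : ∀ d e x y, x ∈ QuantumSkew.piece q G d → y ∈ QuantumSkew.piece q G e →
    toFun x y ∈ QuantumSkew.piece q G (d + e - 2)

namespace ConstantCocycle

open Cover

section

variable (c : ConstantCocycle q G)

/-- The value has degree -2, and -1 in the next two lemmas. Because of these vanishings G embeds in
the square-zero extension and acts there on the v_i by the same matrices. -/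
theorem grp_grp (g k : G) : c.toFun (QuantumSkew.grp q g) (QuantumSkew.grp q k) = 0 :=
  QuantumSkew.eq_zero_of_mem_piece (by norm_num)
    (c.constant 0 0 _ _ (QuantumSkew.grp_mem_piece g) (QuantumSkew.grp_mem_piece k))

theorem grp_gen (g : G) (i : Fin n) : c.toFun (QuantumSkew.grp q g) (QuantumSkew.gen q G i) = 0 :=
  QuantumSkew.eq_zero_of_mem_piece (by norm_num)
    (c.constant 0 1 _ _ (QuantumSkew.grp_mem_piece g) (QuantumSkew.gen_mem_piece i))

theorem gen_grp (g : G) (i : Fin n) : c.toFun (QuantumSkew.gen q G i) (QuantumSkew.grp q g) = 0 :=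
  QuantumSkew.eq_zero_of_mem_piece (by norm_num)
    (c.constant 1 0 _ _ (QuantumSkew.gen_mem_piece i) (QuantumSkew.grp_mem_piece g))

end

variable [MulSemiringAction G (FreePoly n)] [SMulCommClass G ℂ (FreePoly n)]

variable (h : CompatibleActions q M) (c : ConstantCocycle q G)

/-- The homomorphism `ℂ⟨v_1, …, v_n⟩[t] ⋊ G → E` to the square-zero extension defined by `c`. -/
def toTwisted : Cover n G →ₐ[ℂ] TwistedExt c.toUnitalTwoCocycle :=
  lift h (fun i => TwistedExt.mk _ (QuantumSkew.gen q G i) 0) (TwistedExt.mk _ 0 1)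
    { toFun := fun g => TwistedExt.mk _ (QuantumSkew.grp q g) 0
      map_one' := rfl
      map_mul' := fun g k => by ext1 <;> simp [c.grp_grp] }
    (fun i => by ext1 <;> simp) (fun g => by ext1 <;> simp)
    (fun g i => by
      have hs : ∀ k, TwistedExt.mk c.toUnitalTwoCocycle (QuantumSkew.gen q G k) 0 *
          TwistedExt.mk _ (QuantumSkew.grp q g) 0 =
          TwistedExt.mk _ (QuantumSkew.gen q G k * QuantumSkew.grp q g) 0 := fun k => by
        ext1 <;> simp [c.gen_grp]
      change TwistedExt.mk _ (QuantumSkew.grp q g) 0 * TwistedExt.mk _ (QuantumSkew.gen q G i) 0 =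
        ∑ k, M g k i • (TwistedExt.mk _ (QuantumSkew.gen q G k) 0 *
          TwistedExt.mk _ (QuantumSkew.grp q g) 0)
      simp only [hs]
      ext1
      · rw [← TwistedExt.fstHom_apply, ← TwistedExt.fstHom_apply, map_sum]
        simp [QuantumSkew.grp_mul_gen h.smul_gen]
      · rw [← TwistedExt.sndHom_apply, ← TwistedExt.sndHom_apply, map_sum]
        simp [c.grp_gen])

theorem toTwisted_var (i : Fin n) :
    c.toTwisted h (var G i) = TwistedExt.mk _ (QuantumSkew.gen q G i) 0 := lift_var ..

theorem toTwisted_t : c.toTwisted h (t n G) = TwistedExt.mk _ 0 1 := lift_t ..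

theorem toTwisted_grp (g : G) :
    c.toTwisted h (grp n g) = TwistedExt.mk _ (QuantumSkew.grp q g) 0 := lift_grp ..

theorem fst_toTwisted (y : Cover n G) : (c.toTwisted h y).fst = specialize h y := by
  induction y using Cover.induction with
  | add a b ha hb => simp [ha, hb]
  | smul z a ha => simp [ha]
  | grp g => simp [toTwisted_grp]
  | var i a ha => simp [toTwisted_var, ha]
  | t a ha => simp [toTwisted_t, ha]

/-- The linear map measuring the deviation of `toTwisted` from `specialize`. -/
def correction : Cover n G →ₗ[ℂ] QuantumSkew q G :=
  TwistedExt.sndHom _ ∘ₗ (c.toTwisted h).toLinearMap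

theorem toTwisted_eq (y : Cover n G) :
    c.toTwisted h y = TwistedExt.mk _ (specialize h y) (c.correction h y) :=
  TwistedExt.ext (c.fst_toTwisted h y) rfl

@[simp] theorem correction_grp (g : G) : c.correction h (grp n g) = 0 := by
  simp [correction, toTwisted_grp]

theorem correction_var_mul (i : Fin n) (y : Cover n G) :
    c.correction h (var G i * y) = QuantumSkew.gen q G i * c.correction h y +
      c.toFun (QuantumSkew.gen q G i) (specialize h y) := by
  simp [correction, toTwisted_var, ← fst_toTwisted h c]

theorem correction_t_mul (y : Cover n G) : c.correction h (t n G * y) = specialize h y := by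
  simp [correction, toTwisted_t, fst_toTwisted]

theorem toTwisted_t_mul (y : Cover n G) :
    c.toTwisted h (t n G * y) = TwistedExt.mk _ 0 (specialize h y) := by
  rw [toTwisted_eq, correction_t_mul, map_mul, specialize_t, zero_mul]

/-- Multiplication by t moves the specialization into the second component. Every identity extracted
from the cocycle passes through this. -/
theorem specialize_eq_zero_of_toTwisted_t_mul {y : Cover n G}
    (hy : c.toTwisted h (t n G * y) = 0) : specialize h y = 0 := by
  rw [toTwisted_t_mul] at hy
  exact congrArg TwistedExt.snd hy

theorem correction_mem_piece {d : ℤ} {y : Cover n G} (hy : y ∈ Cover.piece h d) :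
    c.correction h y ∈ QuantumSkew.piece q G (d - 2) := by
  refine piece_le h (fun d => (QuantumSkew.piece q G (d - 2)).comap (c.correction h))
    (fun g => by simp) (fun d i y hy hy' => ?_) (fun d y hy _ => ?_) d hy
  · rw [Submodule.mem_comap] at hy' ⊢
    rw [correction_var_mul]
    refine add_mem ?_ ?_
    · have := QuantumSkew.gen_mul_mem_piece _ i hy'
      rwa [sub_add_eq_add_sub] at this
    · have := c.constant 1 d _ _ (QuantumSkew.gen_mem_piece i) (specialize_mem_piece h hy)
      rwa [add_comm 1 d] at this
  · rw [Submodule.mem_comap, correction_t_mul, add_sub_cancel_right]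
    exact specialize_mem_piece h hy

/-- The element of degree `0` of the cover corresponding to `c(v_i, v_j)`. -/
def lowerTerm (i j : Fin n) : Cover n G :=
  QuantumSkew.constantPart (c.toFun (QuantumSkew.gen q G i) (QuantumSkew.gen q G j))

theorem lowerTerm_mem_piece (i j : Fin n) : c.lowerTerm i j ∈ Cover.piece h 0 :=
  QuantumSkew.constantPart_mem_piece h _

theorem specialize_lowerTerm (i j : Fin n) : specialize h (c.lowerTerm i j) =
    c.toFun (QuantumSkew.gen q G i) (QuantumSkew.gen q G j) :=
  specialize_constantPart h
    (c.constant 1 1 _ _ (QuantumSkew.gen_mem_piece i) (QuantumSkew.gen_mem_piece j))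

/-- The quadratic relation `v_i v_j - q_{ij} v_j v_i - t (c(v_i, v_j) - q_{ij} c(v_j, v_i))`. -/
def rel (i j : Fin n) : Cover n G :=
  var G i * var G j - q i j • (var G j * var G i) -
    t n G * (c.lowerTerm i j - q i j • c.lowerTerm j i)

/-- In the extension (v_i, 0)(v_j, 0) = (v_i v_j, c(v_i, v_j)); the t-term of the relation subtracts
precisely the second component of the q-commutator. -/
theorem toTwisted_rel (i j : Fin n) : c.toTwisted h (c.rel i j) = 0 := by
  rw [rel, map_sub, toTwisted_t_mul, map_sub, map_smul, map_mul, map_mul, toTwisted_var,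
    toTwisted_var, map_sub, map_smul, specialize_lowerTerm, specialize_lowerTerm]
  ext1
  · simp [QuantumSkew.gen_mul_gen i j]
  · simp

theorem rel_mem_piece (i j : Fin n) : c.rel i j ∈ Cover.piece h 2 := by
  refine sub_mem (sub_mem ?_ (Submodule.smul_mem _ _ ?_)) ?_
  · exact mul_mem_piece h (var_mem_piece h i) (var_mem_piece h j)
  · exact mul_mem_piece h (var_mem_piece h j) (var_mem_piece h i)
  · exact t_mul_mem_piece h (sub_mem (c.lowerTerm_mem_piece h i j)
      (Submodule.smul_mem _ _ (c.lowerTerm_mem_piece h j i)))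


/-- Renaming i ↔ j makes the q-swapped half of a relation a second copy of the first half, whence
the factor 2 in `sum_rel_mul`. -/
theorem sum_twist {W : Fin n → Fin n → Cover n G} (hW : ∀ i j, W j i = -(q i j • W i j))
    (B : Fin n → Fin n → Cover n G) :
    ∑ i, ∑ j, q i j • (B j i * W i j) = - ∑ i, ∑ j, B i j * W i j := by
  rw [Finset.sum_comm, ← Finset.sum_neg_distrib]
  refine Finset.sum_congr rfl fun i _ => ?_
  rw [← Finset.sum_neg_distrib]
  refine Finset.sum_congr rfl fun j _ => ?_
  rw [hW j i, mul_neg, mul_smul_comm, neg_neg]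

/-- Contraction of the relations with a twisted antisymmetric tensor. -/
theorem sum_rel_mul {W : Fin n → Fin n → Cover n G}
    (hW : ∀ i j, W j i = -(q i j • W i j)) :
    ∑ i, ∑ j, c.rel i j * W i j = (2 : ℂ) •
      (∑ i, ∑ j, var G i * (var G j * W i j) - t n G * ∑ i, ∑ j, c.lowerTerm i j * W i j) := by
  simp only [rel, sub_mul, mul_assoc, smul_mul_assoc, mul_sub, mul_smul_comm,
    Finset.sum_sub_distrib]
  have h1 := sum_twist hW (fun i j => var G i * var G j)
  have h2 := sum_twist hW (fun i j => t n G * c.lowerTerm i j)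
  simp only [mul_assoc] at h1 h2
  rw [h1, h2]
  simp only [Finset.mul_sum]
  module

section relIdeal

/-- The ideal of the cover generated by the relations. -/
def relIdeal (c : ConstantCocycle q G) : Ideal (Cover n G) :=
  Ideal.span {x | ∃ i j y, x = c.rel i j * y}

theorem rel_mul_mem (i j : Fin n) (y : Cover n G) : c.rel i j * y ∈ c.relIdeal :=
  Ideal.subset_span ⟨i, j, y, rfl⟩

theorem smul_mem_relIdeal (z : ℂ) {x : Cover n G} (hx : x ∈ c.relIdeal) : z • x ∈ c.relIdeal :=
  Submodule.smul_of_tower_mem _ z hx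

instance : c.relIdeal.IsTwoSided where
  mul_mem_of_left {x} b hx := by
    induction hx using Submodule.span_induction with
    | mem x hx =>
      obtain ⟨i, j, y, rfl⟩ := hx
      rw [mul_assoc]
      exact c.rel_mul_mem i j _
    | zero => rw [zero_mul]; exact zero_mem _
    | add x y _ _ hx hy => rw [add_mul]; exact add_mem hx hy
    | smul a x _ hx => rw [smul_eq_mul, mul_assoc]; exact c.relIdeal.mul_mem_left a hx

theorem toTwisted_eq_zero {x : Cover n G} (hx : x ∈ c.relIdeal) : c.toTwisted h x = 0 := by
  induction hx using Submodule.span_induction with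
  | mem x hx =>
    obtain ⟨i, j, y, rfl⟩ := hx
    rw [map_mul, toTwisted_rel, zero_mul]
  | zero => exact map_zero _
  | add x y _ _ hx hy => rw [map_add, hx, hy, add_zero]
  | smul a x _ hx => rw [smul_eq_mul, map_mul, hx, mul_zero]

theorem specialize_eq_zero {x : Cover n G} (hx : x ∈ c.relIdeal) : specialize h x = 0 := by
  rw [← c.fst_toTwisted h, c.toTwisted_eq_zero h hx, TwistedExt.fst_zero]

theorem proj_mem_relIdeal {x : Cover n G} (hx : x ∈ c.relIdeal) (d : ℤ) :
    proj h d x ∈ c.relIdeal := by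
  induction hx using Submodule.span_induction generalizing d with
  | mem x hx =>
    obtain ⟨i, j, y, rfl⟩ := hx
    rw [proj_mul_of_mem_piece h (c.rel_mem_piece h i j)]
    exact c.rel_mul_mem i j _
  | zero => rw [map_zero]; exact zero_mem _
  | add x y _ _ hx hy => rw [map_add]; exact add_mem (hx d) (hy d)
  | smul a x _ hx =>
    rw [smul_eq_mul]
    induction a using Cover.induction generalizing d with
    | add a b ha hb => rw [add_mul, map_add]; exact add_mem (ha d) (hb d)
    | smul z a ha => rw [smul_mul_assoc, map_smul]; exact c.smul_mem_relIdeal z (ha d)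
    | grp g => rw [proj_grp_mul]; exact c.relIdeal.mul_mem_left _ (hx d)
    | var i a ha => rw [mul_assoc, proj_var_mul]; exact c.relIdeal.mul_mem_left _ (ha _)
    | t a ha => rw [mul_assoc, proj_t_mul]; exact c.relIdeal.mul_mem_left _ (ha _)

/-- Half of a contraction of the relations: modulo the ideal, a quadratic expression with
antisymmetric coefficients may be traded for t times its lower term. -/
theorem sum_lowerTerm_mem {W : Fin n → Fin n → Cover n G}
    (hW : ∀ i j, W j i = -(q i j • W i j)) :
    ∑ i, ∑ j, var G i * (var G j * W i j) - t n G * ∑ i, ∑ j, c.lowerTerm i j * W i j ∈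
      c.relIdeal := by
  have h1 := c.sum_rel_mul hW
  have h2 : ∑ i, ∑ j, c.rel i j * W i j ∈ c.relIdeal :=
    sum_mem fun i _ => sum_mem fun j _ => c.rel_mul_mem i j _
  rw [h1] at h2
  simpa using c.smul_mem_relIdeal (2⁻¹ : ℂ) h2

include h in
/-- The span of the relations is stable under `G`. -/
theorem grp_mul_rel (g : G) (i j : Fin n) :
    ∃ C : Fin n → Fin n → Cover n G, grp n g * c.rel i j = ∑ k, ∑ l, c.rel k l * C k l := by
  -- Coefficients of g(v_i v_j - q_ij v_j v_i) on the monomials v_k v_l; they are antisymmetric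
  -- because G preserves the relations of S_q(V).
  let C : Fin n → Fin n → ℂ := fun k l => M g k i * M g l j - q i j * (M g k j * M g l i)
  have hgen : ∑ k, ∑ l, C k l • (SkewCommAlgebra.gen q k * SkewCommAlgebra.gen q l) = 0 := by
    have h1 := congrArg (fun x => g • x) (SkewCommAlgebra.gen_mul_gen q i j)
    simp only [smul_mul', smul_comm g, h.smul_gen] at h1
    rw [← sub_eq_zero] at h1
    rw [← h1]
    simp only [C, Finset.sum_mul_sum, Finset.smul_sum, smul_mul_smul_comm, smul_smul]
    rw [← Finset.sum_sub_distrib]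
    refine Finset.sum_congr rfl fun k _ => ?_
    rw [← Finset.sum_sub_distrib]
    exact Finset.sum_congr rfl fun l _ => by module
  have hC : ∀ k l, C l k = -(q k l * C k l) := fun k l => by
    rw [QuantumSym.antisymm_of_sum_eq_zero h.q_diag h.q_inv C hgen k l, neg_mul]
  let W : Fin n → Fin n → Cover n G := fun k l => C k l • grp n g
  have hW : ∀ k l, W l k = -(q k l • W k l) := fun k l => by
    simp only [W, hC k l, smul_smul, neg_smul]
  let e : Cover n G := ∑ k, ∑ l, c.lowerTerm k l * W k l -
    grp n g * (c.lowerTerm i j - q i j • c.lowerTerm j i)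
  have hvv : ∀ i j, grp n g * (var G i * var G j) =
      ∑ k, ∑ l, (M g k i * M g l j) • (var G k * (var G l * grp n g)) := fun i j => by
    rw [← mul_assoc, grp_mul_var h, Finset.sum_mul]
    refine Finset.sum_congr rfl fun k _ => ?_
    rw [smul_mul_assoc, mul_assoc, grp_mul_var h, Finset.mul_sum, Finset.smul_sum]
    simp only [mul_smul_comm, smul_smul]
  have heq : grp n g * c.rel i j = (2⁻¹ : ℂ) • ∑ k, ∑ l, c.rel k l * W k l + t n G * e := by
    rw [c.sum_rel_mul hW, inv_smul_smul₀ two_ne_zero, rel, mul_sub, mul_sub, mul_smul_comm, hvv,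
      hvv]
    have ht : grp n g * (t n G * (c.lowerTerm i j - q i j • c.lowerTerm j i)) =
        t n G * (grp n g * (c.lowerTerm i j - q i j • c.lowerTerm j i)) := by
      rw [← mul_assoc, ← mul_assoc, t_mul_comm h]
    rw [ht]
    simp only [W, C, e, mul_smul_comm, sub_smul, Finset.sum_sub_distrib, Finset.smul_sum, smul_smul,
      mul_sub]
    abel
  -- The defect e has degree 0, and t e is killed in the extension because all the relations are.
  have he : e = 0 := by
    refine eq_zero_of_specialize_eq_zero₀ h ?_ ?_
    · refine sub_mem (sum_mem fun k _ => sum_mem fun l _ => ?_) (grp_mul_mem_piece h ?_ g)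
      · rw [mul_smul_comm]
        exact Submodule.smul_mem _ _
          (mul_mem_piece h (c.lowerTerm_mem_piece h k l) (grp_mem_piece h g))
      · exact sub_mem (c.lowerTerm_mem_piece h i j)
          (Submodule.smul_mem _ _ (c.lowerTerm_mem_piece h j i))
    · refine c.specialize_eq_zero_of_toTwisted_t_mul h ?_
      rw [← sub_eq_of_eq_add' heq, map_sub, map_mul, toTwisted_rel, map_smul, map_sum]
      simp [toTwisted_rel]
  refine ⟨fun k l => (2⁻¹ : ℂ) • W k l, ?_⟩
  rw [heq, he, mul_zero, add_zero]
  simp only [mul_smul_comm, Finset.smul_sum]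

include h in
/-- Every element of the ideal is a combination of relations and generators, with coefficients in
the ideal at the generators. -/
theorem exists_eq_sum_of_mem {x : Cover n G} (hx : x ∈ c.relIdeal) :
    ∃ (y : Fin n → Fin n → Cover n G) (z : Fin n → Cover n G), (∀ i, z i ∈ c.relIdeal) ∧
      x = ∑ i, ∑ j, c.rel i j * y i j + ∑ i, var G i * z i := by
  let S : AddSubmonoid (Cover n G) :=
    { carrier := {x | ∃ (y : Fin n → Fin n → Cover n G) (z : Fin n → Cover n G),
        (∀ i, z i ∈ c.relIdeal) ∧ x = ∑ i, ∑ j, c.rel i j * y i j + ∑ i, var G i * z i}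
      zero_mem' := ⟨0, 0, fun i => zero_mem _, by simp⟩
      add_mem' := by
        rintro _ _ ⟨y, z, hz, rfl⟩ ⟨y', z', hz', rfl⟩
        refine ⟨fun i j => y i j + y' i j, fun i => z i + z' i, fun i => add_mem (hz i) (hz' i), ?_⟩
        simp only [mul_add, Finset.sum_add_distrib]
        abel }
  have hrel : ∀ i j y, c.rel i j * y ∈ S := fun i j y => by
    refine ⟨Pi.single i (Pi.single j y), 0, fun i => zero_mem _, ?_⟩
    rw [Finset.sum_eq_single i, Finset.sum_eq_single j]
    · simp
    · intro l _ hl; simp [hl]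
    · simp
    · intro k _ hk; simp [hk]
    · simp
  have hvar : ∀ i, ∀ z ∈ c.relIdeal, var G i * z ∈ S := fun i z hz => by
    refine ⟨0, Pi.single i z, fun k => ?_, ?_⟩
    · rw [Pi.single_apply]
      split_ifs
      · exact hz
      · exact zero_mem _
    · simp [Pi.single_apply]
  change x ∈ S
  induction hx using Submodule.span_induction with
  | mem x hx =>
    obtain ⟨i, j, y, rfl⟩ := hx
    exact hrel i j y
  | zero => exact zero_mem _
  | add x x' _ _ hx hx' => exact add_mem hx hx'
  | smul a x hxJ hx =>
    rw [smul_eq_mul]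
    induction a using Cover.induction with
    | add a b ha hb => rw [add_mul]; exact add_mem ha hb
    | smul w a ha =>
      obtain ⟨y, z, hz, hx⟩ := ha
      rw [smul_mul_assoc, hx, smul_add, Finset.smul_sum, Finset.smul_sum]
      refine add_mem (sum_mem fun i _ => ?_) (sum_mem fun i _ => ?_)
      · rw [Finset.smul_sum]
        exact sum_mem fun j _ => by rw [← mul_smul_comm]; exact hrel _ _ _
      · rw [← mul_smul_comm]
        exact hvar _ _ (c.smul_mem_relIdeal w (hz i))
    -- Group elements pass the relations by `grp_mul_rel` and the v_i by the linear action.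
    | grp g =>
      obtain ⟨y, z, hz, rfl⟩ := hx
      rw [mul_add, Finset.mul_sum, Finset.mul_sum]
      refine add_mem (sum_mem fun i _ => ?_) (sum_mem fun i _ => ?_)
      · rw [Finset.mul_sum]
        refine sum_mem fun j _ => ?_
        obtain ⟨C, hC⟩ := c.grp_mul_rel h g i j
        rw [← mul_assoc, hC, Finset.sum_mul]
        refine sum_mem fun k _ => ?_
        rw [Finset.sum_mul]
        exact sum_mem fun l _ => by rw [mul_assoc]; exact hrel _ _ _
      · rw [← mul_assoc, grp_mul_var h, Finset.sum_mul]
        refine sum_mem fun k _ => ?_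
        rw [smul_mul_assoc, mul_assoc, ← mul_smul_comm]
        exact hvar _ _ (c.smul_mem_relIdeal _ (c.relIdeal.mul_mem_left _ (hz i)))
    | var i a ha =>
      rw [mul_assoc]
      exact hvar _ _ (c.relIdeal.mul_mem_left a hxJ)
    | t a ha =>
      obtain ⟨y, z, hz, hx⟩ := ha
      rw [mul_assoc, hx, mul_add, Finset.mul_sum, Finset.mul_sum]
      refine add_mem (sum_mem fun i _ => ?_) (sum_mem fun i _ => ?_)
      · rw [Finset.mul_sum]
        refine sum_mem fun j _ => ?_
        rw [← mul_assoc, t_mul_comm h, mul_assoc]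
        exact hrel _ _ _
      · rw [← mul_assoc, t_mul_comm h, mul_assoc]
        exact hvar _ _ (c.relIdeal.mul_mem_left _ (hz i))

end relIdeal

end ConstantCocycle

end

/-! ### Jacobi identity, kernel of the specialization, Koszul exactness -/

noncomputable section

variable {n : ℕ} {G : Type*} [Group G] {q : Fin n → Fin n → ℂ} {M : G → Fin n → Fin n → ℂ}
  [MulSemiringAction G (QuantumSym q)] [SMulCommClass G ℂ (QuantumSym q)]
  [MulSemiringAction G (FreePoly n)] [SMulCommClass G ℂ (FreePoly n)]

namespace ConstantCocycle

open Cover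

variable (h : CompatibleActions q M) (c : ConstantCocycle q G)

include h

/-- The Jacobi identity for the lower terms, contracted with a scalar tensor. -/
theorem jacobi_scalar {Z : Fin n → Fin n → Fin n → ℂ}
    (h12 : ∀ i j k, Z j i k = -(q i j * Z i j k)) (h23 : ∀ i j k, Z i k j = -(q j k * Z i j k)) :
    ∑ i, ∑ j, ∑ k, Z i j k • (var G i * c.lowerTerm j k - c.lowerTerm i j * var G k) = 0 := by
  set e := ∑ i, ∑ j, ∑ k, Z i j k • (var G i * c.lowerTerm j k - c.lowerTerm i j * var G k)
    with he
  -- The cubic tensor is reduced in two ways: in its last two indices here, in its first two in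
  -- `h2`. The cubic terms cancel in the difference and leave t e.
  have h1 : ∀ i, var G i * (∑ j, ∑ k, var G j * (var G k * (Z i j k • (1 : Cover n G))) -
      t n G * ∑ j, ∑ k, c.lowerTerm j k * (Z i j k • (1 : Cover n G))) ∈ c.relIdeal := fun i =>
    c.relIdeal.mul_mem_left _ (c.sum_lowerTerm_mem fun j k => by rw [h23, neg_smul, smul_smul])
  have h2 : ∀ k, (∑ i, ∑ j, var G i * (var G j * (Z i j k • var G k)) -
      t n G * ∑ i, ∑ j, c.lowerTerm i j * (Z i j k • var G k)) ∈ c.relIdeal := fun k =>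
    c.sum_lowerTerm_mem fun i j => by rw [h12, neg_smul, smul_smul]
  have h3 : t n G * e ∈ c.relIdeal := by
    have h4 := sub_mem (sum_mem (t := Finset.univ) fun k _ => h2 k)
      (sum_mem (t := Finset.univ) fun i _ => h1 i)
    convert h4 using 1
    have h5 : ∀ B : Fin n → Fin n → Fin n → Cover n G,
        ∑ k, ∑ i, ∑ j, B i j k = ∑ i, ∑ j, ∑ k, B i j k := fun B => by
      rw [Finset.sum_comm]
      exact Finset.sum_congr rfl fun i _ => Finset.sum_comm
    have h6 : ∀ i (a : Cover n G), var G i * (t n G * a) = t n G * (var G i * a) := fun i a => by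
      rw [← mul_assoc, ← mul_assoc, t_mul_comm h]
    have e2 : ∑ k, (∑ i, ∑ j, var G i * (var G j * (Z i j k • var G k)) -
        t n G * ∑ i, ∑ j, c.lowerTerm i j * (Z i j k • var G k)) =
        ∑ i, ∑ j, ∑ k, Z i j k • (var G i * (var G j * var G k)) -
          ∑ i, ∑ j, ∑ k, Z i j k • (t n G * (c.lowerTerm i j * var G k)) := by
      simp only [Finset.sum_sub_distrib, Finset.mul_sum, mul_smul_comm]
      rw [h5 (fun i j k => Z i j k • (var G i * (var G j * var G k))),
        h5 (fun i j k => Z i j k • (t n G * (c.lowerTerm i j * var G k)))]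
    rw [e2, he]
    simp only [Finset.sum_sub_distrib, mul_sub, Finset.mul_sum, mul_smul_comm, mul_one, smul_sub,
      h6]
    abel
  -- e has degree 1, so vanishing at t = 0 already gives e = 0.
  refine eq_zero_of_specialize_eq_zero₁ h ?_
    (c.specialize_eq_zero_of_toTwisted_t_mul h (c.toTwisted_eq_zero h h3))
  refine sum_mem fun i _ => sum_mem fun j _ => sum_mem fun k _ => Submodule.smul_mem _ _
    (sub_mem ?_ ?_)
  · exact mul_mem_piece h (var_mem_piece h i) (c.lowerTerm_mem_piece h j k)
  · exact mul_mem_piece h (c.lowerTerm_mem_piece h i j) (var_mem_piece h k)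

/-- The Jacobi identity for the lower terms. -/
theorem jacobi {Z : Fin n → Fin n → Fin n → Cover n G}
    (h12 : ∀ i j k, Z j i k = -(q i j • Z i j k)) (h23 : ∀ i j k, Z i k j = -(q j k • Z i j k)) :
    ∑ i, ∑ j, ∑ k, (var G i * c.lowerTerm j k - c.lowerTerm i j * var G k) * Z i j k = 0 := by
  classical
  -- Z multiplies on the right, so each of its coordinates in a ℂ-basis of the cover is a scalar
  -- tensor with the same symmetries.
  let b := Module.Basis.ofVectorSpace ℂ (Cover n G)
  let s : Finset (Module.Basis.ofVectorSpaceIndex ℂ (Cover n G)) :=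
    Finset.univ.biUnion fun i => Finset.univ.biUnion fun j => Finset.univ.biUnion fun k =>
      (b.repr (Z i j k)).support
  have hZ : ∀ i j k, Z i j k = ∑ m ∈ s, b.repr (Z i j k) m • b m := fun i j k => by
    conv_lhs => rw [← b.linearCombination_repr (Z i j k), Finsupp.linearCombination_apply]
    refine Finsupp.sum_of_support_subset _ (fun m hm => ?_) _ (by simp)
    simp only [s, Finset.mem_biUnion, Finset.mem_univ, true_and]
    exact ⟨i, j, k, hm⟩
  have hsum : ∀ (B : Fin n → Fin n → Fin n → Cover n G),
      ∑ i, ∑ j, ∑ k, B i j k * Z i j k =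
        ∑ m ∈ s, (∑ i, ∑ j, ∑ k, b.repr (Z i j k) m • B i j k) * b m := fun B => by
    simp only [Finset.sum_mul, smul_mul_assoc]
    symm
    rw [Finset.sum_comm]
    refine Finset.sum_congr rfl fun i _ => ?_
    rw [Finset.sum_comm]
    refine Finset.sum_congr rfl fun j _ => ?_
    rw [Finset.sum_comm]
    refine Finset.sum_congr rfl fun k _ => ?_
    conv_rhs => rw [hZ i j k, Finset.mul_sum]
    simp only [mul_smul_comm]
  rw [hsum]
  refine Finset.sum_eq_zero fun m _ => ?_
  rw [c.jacobi_scalar h, zero_mul]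
  · intro i j k
    rw [h12, map_neg, map_smul]; simp
  · intro i j k
    rw [h23, map_neg, map_smul]; simp

/-- The kernel of the specialization is generated by the relations and `t`. -/
theorem exists_eq_add_t_mul {x : Cover n G} (hx : specialize h x = 0) :
    ∃ j ∈ c.relIdeal, ∃ y, x = j + t n G * y := by
  -- Modulo K the generators satisfy the relations of S_q(V) ⋊ G. The quotient map thus factors
  -- through the specialization, whose kernel must lie in K.
  let K : Ideal (Cover n G) :=
    { carrier := {x | ∃ j ∈ c.relIdeal, ∃ y, x = j + t n G * y}
      zero_mem' := ⟨0, zero_mem _, 0, by simp⟩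
      add_mem' := by
        rintro _ _ ⟨j, hj, y, rfl⟩ ⟨j', hj', y', rfl⟩
        exact ⟨j + j', add_mem hj hj', y + y', by rw [mul_add]; abel⟩
      smul_mem' := by
        rintro a _ ⟨j, hj, y, rfl⟩
        exact ⟨a * j, c.relIdeal.mul_mem_left a hj, a * y, by
          rw [smul_eq_mul, mul_add, ← mul_assoc, ← t_mul_comm h, mul_assoc]⟩ }
  have : K.IsTwoSided := ⟨by
    rintro _ b ⟨j, hj, y, rfl⟩
    exact ⟨j * b, c.relIdeal.mul_mem_right b hj, y * b, by rw [add_mul, mul_assoc]⟩⟩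
  let p : Cover n G →ₐ[ℂ] Cover n G ⧸ K := Ideal.Quotient.mkₐ ℂ K
  have hp : ∀ x, p x = 0 ↔ x ∈ K := fun x => Ideal.Quotient.eq_zero_iff_mem
  have hpt : p (t n G) = 0 := (hp _).2 ⟨0, zero_mem _, 1, by simp⟩
  have hpv : ∀ i j, p (var G i) * p (var G j) = q i j • (p (var G j) * p (var G i)) := by
    intro i j
    rw [← map_mul, ← map_mul, ← map_smul, ← sub_eq_zero, ← map_sub, hp]
    exact ⟨c.rel i j * 1, c.rel_mul_mem i j 1, c.lowerTerm i j - q i j • c.lowerTerm j i, by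
      rw [mul_one, rel, sub_add_cancel]⟩
  let f : QuantumSym q →ₐ[ℂ] Cover n G ⧸ K := SkewCommAlgebra.lift (fun i => p (var G i)) hpv
  have hf : ∀ i, f (SkewCommAlgebra.gen q i) = p (var G i) := SkewCommAlgebra.lift_gen _ _
  let u : G →* Cover n G ⧸ K := (p : Cover n G →* Cover n G ⧸ K).comp (grp n)
  have hu : ∀ g, u g = p (grp n g) := fun g => rfl
  have hfu : ∀ g a, f (g • a) * u g = u g * f a := by
    intro g a
    have : LinearMap.mulRight ℂ (u g) ∘ₗ f.toLinearMap ∘ₗ DistribSMul.toLinearMap ℂ _ g =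
        LinearMap.mulLeft ℂ (u g) ∘ₗ f.toLinearMap := by
      refine SkewCommAlgebra.linearMap_ext (by simp) (fun i y hy => ?_)
      replace hy : f (g • y) * u g = u g * f y := hy
      change f (g • (SkewCommAlgebra.gen q i * y)) * u g = u g * f (SkewCommAlgebra.gen q i * y)
      rw [smul_mul', map_mul, map_mul, mul_assoc, hy, ← mul_assoc, ← mul_assoc, h.smul_gen]
      congr 1
      rw [map_sum, hf, hu, ← map_mul, grp_mul_var h, map_sum, Finset.sum_mul]
      refine Finset.sum_congr rfl fun k _ => ?_
      rw [map_smul, map_smul, hf, map_mul, smul_mul_assoc]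
    exact LinearMap.congr_fun this a
  let Ψ : QuantumSkew q G →ₐ[ℂ] Cover n G ⧸ K := SkewRing.lift f u hfu
  have hΨ : ∀ y, Ψ (specialize h y) = p y := by
    intro y
    induction y using Cover.induction with
    | add a b ha hb => simp only [map_add, ha, hb]
    | smul z a ha => simp only [map_smul, ha]
    | grp g =>
      rw [specialize_grp, SkewRing.grp_apply]
      exact (SkewRing.lift_single f u hfu g 1).trans (by rw [map_one, one_mul, hu])
    | var i a ha =>
      rw [map_mul, map_mul, ha, map_mul, specialize_var]
      congr 1
      exact (SkewRing.lift_single f u hfu 1 _).trans (by rw [map_one, mul_one, hf])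
    | t a ha => rw [map_mul, map_mul, specialize_t, map_zero, zero_mul, map_mul, hpt, zero_mul]
  exact (hp x).1 (by rw [← hΨ, hx, map_zero])

theorem exists_eq_add_t_mul_of_mem_piece {d : ℤ} {x : Cover n G} (hxd : x ∈ Cover.piece h d)
    (hx : specialize h x = 0) :
    ∃ j ∈ c.relIdeal, ∃ y ∈ Cover.piece h (d - 2), x = j + t n G * y := by
  obtain ⟨j, hj, y, hxy⟩ := c.exists_eq_add_t_mul h hx
  refine ⟨proj h d j, c.proj_mem_relIdeal h hj d, proj h (d - 2) y, proj_mem_piece h _ _, ?_⟩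
  rw [← (mem_piece h).1 hxd, hxy, map_add, proj_t_mul]

omit h in
theorem antisymmetrize (hi : ∀ i j, q i j * q j i = 1) (y : Fin n → Fin n → Cover n G)
    (i j : Fin n) : (y j i - q i j • y i j) = -(q i j • (y i j - q j i • y j i)) := by
  rw [smul_sub, smul_smul, hi]
  module

/-- Exactness of the Koszul complex of `S_q(V)`, lifted to the cover. -/
theorem exists_koszul_lift {d : ℤ} (hd : 0 ≤ d) {Y : Fin n → Fin n → Cover n G}
    (hY : ∀ i j, Y j i = -(q i j • Y i j)) (hYd : ∀ i j, Y i j ∈ Cover.piece h d)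
    (hY0 : ∀ i, ∑ j, QuantumSkew.gen q G j * specialize h (Y i j) = 0) :
    ∃ (Z : Fin n → Fin n → Fin n → Cover n G) (Y' J : Fin n → Fin n → Cover n G),
      (∀ i j k, Z i j k ∈ Cover.piece h (d - 1)) ∧
      (∀ i j k, Z j i k = -(q i j • Z i j k)) ∧ (∀ i j k, Z i k j = -(q j k • Z i j k)) ∧
      (∀ i j, Y' i j ∈ Cover.piece h (d - 2)) ∧ (∀ i j, Y' j i = -(q i j • Y' i j)) ∧
      (∀ i j, J i j ∈ c.relIdeal) ∧
      ∀ i j, Y i j = ∑ k, var G k * Z i j k + t n G * Y' i j + J i j := by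
  have hi := h.q_inv
  let D := fun k => skewDeriv (n := n) G (fun j => q j k) k
  have hd2 : ((d : ℂ) + 2) ≠ 0 := by
    have : (d + 2 : ℤ) ≠ 0 := by omega
    exact_mod_cast this
  -- Koszul homotopy: the twisted antisymmetrization of the gradient of Y, normalized by the Euler
  -- eigenvalue d + 2, which is nonzero as d ≥ 0.
  let Z : Fin n → Fin n → Fin n → Cover n G := fun i j k => ((d : ℂ) + 2)⁻¹ •
    (D k (Y i j) - q k j • D j (Y i k) + (q j i * q k i) • D i (Y j k))
  have hZd : ∀ i j k, Z i j k ∈ Cover.piece h (d - 1) := fun i j k =>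
    Submodule.smul_mem _ _ (add_mem (sub_mem (skewDeriv_mem_piece h _ _ (hYd _ _))
      (Submodule.smul_mem _ _ (skewDeriv_mem_piece h _ _ (hYd _ _))))
      (Submodule.smul_mem _ _ (skewDeriv_mem_piece h _ _ (hYd _ _))))
  have hZ12 : ∀ i j k, Z j i k = -(q i j • Z i j k) := fun i j k => by
    simp only [Z]
    rw [hY i j, map_neg, map_smul]
    match_scalars
    · ring
    · linear_combination (((d : ℂ) + 2)⁻¹ * q k i) * hi i j
    · ring
  have hZ23 : ∀ i j k, Z i k j = -(q j k • Z i j k) := fun i j k => by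
    simp only [Z]
    rw [hY j k, map_neg, map_smul]
    match_scalars
    · linear_combination -(((d : ℂ) + 2)⁻¹) * hi j k
    · ring
    · ring
  have hφ : ∀ i j, specialize h (Y i j - ∑ k, var G k * Z i j k) = 0 := fun i j => by
    have h1 := sum_gen_mul_specialize_skewDeriv h (hYd i j)
    -- Differentiating the cycle condition along v_j. The two correction terms of Z thus contribute
    -- Y_ij each, beside d Y_ij from the Euler identity.
    have h2 : ∀ i j, ∑ k, q k j • (QuantumSkew.gen q G k * specialize h (D j (Y i k))) =
        - specialize h (Y i j) := fun i j => by
      have h3 := congrArg (QuantumSkew.skewDeriv G h.q_diag h.q_inv j) (hY0 i)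
      rw [map_sum, map_zero] at h3
      simp only [QuantumSkew.skewDeriv_gen_mul, Finset.sum_add_distrib, Finset.sum_ite_eq',
        Finset.mem_univ, if_true, ← specialize_skewDeriv] at h3
      exact eq_neg_of_add_eq_zero_right h3
    have h4 := h2 i j
    have h5 := h2 j i
    have h6 : ∑ k, QuantumSkew.gen q G k * specialize h (Z i j k) = ((d : ℂ) + 2)⁻¹ •
        (∑ k, QuantumSkew.gen q G k * specialize h (D k (Y i j)) -
          ∑ k, q k j • (QuantumSkew.gen q G k * specialize h (D j (Y i k))) +
          q j i • ∑ k, q k i • (QuantumSkew.gen q G k * specialize h (D i (Y j k)))) := by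
      rw [← Finset.sum_sub_distrib, Finset.smul_sum, ← Finset.sum_add_distrib, Finset.smul_sum]
      refine Finset.sum_congr rfl fun k _ => ?_
      simp only [Z, map_smul, map_add, map_sub, mul_smul_comm, mul_add, mul_sub, smul_smul]
    rw [map_sub, map_sum]
    simp only [map_mul, specialize_var]
    rw [h6, h1, h4, h5, hY i j, map_neg, map_smul, sub_eq_zero, eq_inv_smul_iff₀ hd2, neg_neg,
      smul_smul, mul_comm (q j i), hi]
    module
  have hDd : ∀ i j, Y i j - ∑ k, var G k * Z i j k ∈ Cover.piece h d := fun i j =>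
    sub_mem (hYd i j) (sum_mem fun k _ => var_mul_mem_piece h (hZd i j k) k)
  choose J hJ y hy hYJ using fun i j => c.exists_eq_add_t_mul_of_mem_piece h (hDd i j) (hφ i j)
  -- The chosen y and J need not be antisymmetric; averaging makes them so and preserves the
  -- decomposition, as its left side is antisymmetric.
  refine ⟨Z, fun i j => (2⁻¹ : ℂ) • (y i j - q j i • y j i),
    fun i j => (2⁻¹ : ℂ) • (J i j - q j i • J j i), hZd, hZ12, hZ23,
    fun i j => Submodule.smul_mem _ _ (sub_mem (hy i j) (Submodule.smul_mem _ _ (hy j i))),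
    fun i j => ?_,
    fun i j => c.smul_mem_relIdeal _ (sub_mem (hJ i j) (c.smul_mem_relIdeal _ (hJ j i))),
    fun i j => ?_⟩
  · simp only [antisymmetrize hi y i j]
    module
  · have h1 : Y j i - ∑ k, var G k * Z j i k = -(q i j • (Y i j - ∑ k, var G k * Z i j k)) := by
      simp only [hY i j, hZ12 i j, mul_neg, mul_smul_comm, Finset.sum_neg_distrib, smul_sub,
        Finset.smul_sum]
      abel
    have h2 : Y i j - ∑ k, var G k * Z i j k = (2⁻¹ : ℂ) • ((Y i j - ∑ k, var G k * Z i j k) -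
        q j i • (Y j i - ∑ k, var G k * Z j i k)) := by
      rw [h1, smul_neg, smul_smul, mul_comm (q j i), hi]
      module
    rw [hYJ i j, hYJ j i] at h2
    rw [← sub_add_cancel (Y i j) (∑ k, var G k * Z i j k), hYJ, h2]
    simp only [mul_smul_comm, mul_sub]
    module

end ConstantCocycle

end

/-! ### Torsion-freeness: t is regular modulo the relations -/

noncomputable section

variable {n : ℕ} {G : Type*} [Group G] {q : Fin n → Fin n → ℂ} {M : G → Fin n → Fin n → ℂ}
  [MulSemiringAction G (QuantumSym q)] [SMulCommClass G ℂ (QuantumSym q)]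
  [MulSemiringAction G (FreePoly n)] [SMulCommClass G ℂ (FreePoly n)]

namespace ConstantCocycle

open Cover

variable (h : CompatibleActions q M) (c : ConstantCocycle q G)

include h

/-- Contraction of the relations with an arbitrary tensor. -/
theorem sum_rel_mul_eq (y : Fin n → Fin n → Cover n G) :
    ∑ i, ∑ j, c.rel i j * y i j =
      ∑ i, ∑ j, var G i * (var G j * (y i j - q j i • y j i)) -
        t n G * ∑ i, ∑ j, c.lowerTerm i j * (y i j - q j i • y j i) := by
  have h1 : ∀ B : Fin n → Fin n → Cover n G,
      ∑ i, ∑ j, q i j • (B j i * y i j) = ∑ i, ∑ j, q j i • (B i j * y j i) :=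
    fun B => Finset.sum_comm
  have h2 := h1 fun i j => var G i * var G j
  have h3 := h1 fun i j => t n G * c.lowerTerm i j
  simp only [mul_assoc] at h2 h3
  simp only [rel, sub_mul, mul_assoc, smul_mul_assoc, mul_sub, mul_smul_comm,
    Finset.sum_sub_distrib, h2, h3, Finset.mul_sum]

/-- The inductive step of the injectivity of multiplication by `t` modulo the relations. -/
theorem mem_relIdeal_of_t_mul_mem_step {d : ℤ} (hd : 0 ≤ d)
    (ih : ∀ x ∈ Cover.piece h (d - 1), t n G * x ∈ c.relIdeal → x ∈ c.relIdeal)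
    {x : Cover n G} (hxd : x ∈ Cover.piece h d) (hx : t n G * x ∈ c.relIdeal) :
    x ∈ c.relIdeal := by
  have htv : ∀ i (a : Cover n G), t n G * (var G i * a) = var G i * (t n G * a) := fun i a => by
    rw [← mul_assoc, ← mul_assoc, t_mul_comm h]
  have hta : ∀ i j (a : Cover n G),
      t n G * (c.lowerTerm i j * a) = c.lowerTerm i j * (t n G * a) := fun i j a => by
    rw [← mul_assoc, ← mul_assoc, t_mul_comm h]
  obtain ⟨y₀, z₀, hz₀, hxyz₀⟩ := c.exists_eq_sum_of_mem h hx
  -- Only total degree d + 2 matters; the relations have degree 2 and each v_i degree 1.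
  let y := fun i j => proj h d (y₀ i j)
  let z := fun i => proj h (d + 1) (z₀ i)
  have hz : ∀ i, z i ∈ c.relIdeal := fun i => c.proj_mem_relIdeal h (hz₀ i) _
  have hxyz : t n G * x = ∑ i, ∑ j, c.rel i j * y i j + ∑ i, var G i * z i := by
    have := congrArg (proj h (d + 2)) hxyz₀
    rw [proj_t_mul, add_sub_cancel_right, (mem_piece h).1 hxd, map_add, map_sum, map_sum] at this
    rw [this]
    congr 1
    · refine Finset.sum_congr rfl fun i _ => ?_
      rw [map_sum]
      refine Finset.sum_congr rfl fun j _ => ?_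
      rw [proj_mul_of_mem_piece h (c.rel_mem_piece h i j), add_sub_cancel_right]
    · refine Finset.sum_congr rfl fun i _ => ?_
      rw [proj_var_mul, show d + 2 - 1 = d + 1 by ring]
  let Y : Fin n → Fin n → Cover n G := fun i j => y i j - q j i • y j i
  have hY : ∀ i j, Y j i = -(q i j • Y i j) := antisymmetrize h.q_inv y
  have hYd : ∀ i j, Y i j ∈ Cover.piece h d := fun i j =>
    sub_mem (proj_mem_piece h _ _) (Submodule.smul_mem _ _ (proj_mem_piece h _ _))
  -- u absorbs the t-terms of the relations, so that t u becomes a sum of left multiples of the v_i.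
  let u := x + ∑ i, ∑ j, c.lowerTerm i j * Y i j
  have hud : u ∈ Cover.piece h d := add_mem hxd (sum_mem fun i _ => sum_mem fun j _ => by
    simpa using mul_mem_piece h (c.lowerTerm_mem_piece h i j) (hYd i j))
  have htu : t n G * u = ∑ i, var G i * (∑ j, var G j * Y i j + z i) := by
    rw [mul_add, hxyz, c.sum_rel_mul_eq h]
    simp only [mul_add, Finset.sum_add_distrib, Finset.mul_sum, Y]
    abel
  -- With twist 0 the derivation strips a leading v_i, giving t x'_i without division.
  let x' := fun i => skewDeriv G (0 : Fin n → ℂ) i u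
  have hx'd : ∀ i, x' i ∈ Cover.piece h (d - 1) := fun i => skewDeriv_mem_piece h _ _ hud
  have htx' : ∀ i, t n G * x' i = ∑ j, var G j * Y i j + z i := fun i => by
    simp only [x']
    rw [← skewDeriv_t_mul, htu, map_sum]
    simp [skewDeriv_var_mul]
  have hu : u = ∑ i, var G i * x' i := by
    rw [← sub_eq_zero]
    apply t_mul_cancel
    rw [mul_sub, htu, Finset.mul_sum, sub_eq_zero]
    exact Finset.sum_congr rfl fun i _ => by rw [htv, htx']
  have hY0 : ∀ i, ∑ j, QuantumSkew.gen q G j * specialize h (Y i j) = 0 := fun i => by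
    have := congrArg (specialize h) (htx' i)
    rw [map_mul, specialize_t, zero_mul, map_add, c.specialize_eq_zero h (hz i), add_zero,
      map_sum] at this
    simpa using this.symm
  obtain ⟨Z, Y', J, hZd, hZ12, hZ23, hY'd, hY', hJ, hYZ⟩ := c.exists_koszul_lift h hd hY hYd hY0
  -- What is left of x'_i after inserting the Koszul decomposition of Y and rewriting its quadratic
  -- part by lower terms. It has degree d - 1 and t X_i lies in the ideal, so `ih` applies.
  let X := fun i => x' i - ∑ j, ∑ k, c.lowerTerm j k * Z i j k - ∑ j, var G j * Y' i j
  have hX : ∀ i, X i ∈ c.relIdeal := fun i => by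
    refine ih _ (sub_mem (sub_mem (hx'd i) (sum_mem fun j _ => sum_mem fun k _ => ?_))
      (sum_mem fun j _ => ?_)) ?_
    · simpa using mul_mem_piece h (c.lowerTerm_mem_piece h j k) (hZd i j k)
    · exact var_mul_mem_piece h (by rw [sub_sub]; exact hY'd i j) j
    · have h1 := c.sum_lowerTerm_mem (hZ23 i)
      have h2 : ∑ j, var G j * J i j ∈ c.relIdeal :=
        sum_mem fun j _ => c.relIdeal.mul_mem_left _ (hJ i j)
      have h3 : t n G * X i = z i + ∑ j, var G j * J i j +
          (∑ j, ∑ k, var G j * (var G k * Z i j k) -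
            t n G * ∑ j, ∑ k, c.lowerTerm j k * Z i j k) := by
        simp only [X, mul_sub, htx', hYZ, mul_add, Finset.mul_sum, Finset.sum_add_distrib, htv]
        abel
      rw [h3]
      exact add_mem (add_mem (hz i) h2) h1
  have hjac := c.jacobi h hZ12 hZ23
  -- Every summand but the last is in the ideal; the last vanishes by the Jacobi identity.
  have hfin : x = ∑ i, var G i * X i +
      (∑ i, ∑ j, var G i * (var G j * Y' i j) - t n G * ∑ i, ∑ j, c.lowerTerm i j * Y' i j) -
      ∑ i, ∑ j, c.lowerTerm i j * J i j +
      ∑ i, ∑ j, ∑ k, (var G i * c.lowerTerm j k - c.lowerTerm i j * var G k) * Z i j k := by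
    have hxu : x = ∑ i, var G i * x' i - ∑ i, ∑ j, c.lowerTerm i j * Y i j := by
      rw [← hu]
      simp only [u, add_sub_cancel_right]
    rw [hxu]
    simp only [X, hYZ, mul_sub, sub_mul, mul_add, Finset.mul_sum, Finset.sum_add_distrib,
      Finset.sum_sub_distrib, hta, mul_assoc]
    abel
  rw [hfin, hjac, add_zero]
  exact sub_mem (add_mem (sum_mem fun i _ => c.relIdeal.mul_mem_left _ (hX i))
    (c.sum_lowerTerm_mem hY')) (sum_mem fun i _ => sum_mem fun j _ =>
      c.relIdeal.mul_mem_left _ (hJ i j))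

theorem mem_relIdeal_of_t_mul_mem_of_mem_piece (m : ℕ) (d : ℤ) (hd : d < m) {x : Cover n G}
    (hxd : x ∈ Cover.piece h d) (hx : t n G * x ∈ c.relIdeal) : x ∈ c.relIdeal := by
  induction m generalizing d x with
  | zero =>
    rw [eq_zero_of_mem_piece h (by simpa using hd) hxd]
    exact zero_mem _
  | succ m ih =>
    rcases lt_or_ge d 0 with hd0 | hd0
    · rw [eq_zero_of_mem_piece h hd0 hxd]
      exact zero_mem _
    · exact c.mem_relIdeal_of_t_mul_mem_step h hd0
        (fun x hxd hx => ih (d - 1) (by push_cast at hd; omega) hxd hx) hxd hx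

/-- Multiplication by `t` is injective modulo the relations. -/
theorem mem_relIdeal_of_t_mul_mem {x : Cover n G} (hx : t n G * x ∈ c.relIdeal) :
    x ∈ c.relIdeal := by
  refine mem_of_proj_mem h c.relIdeal.toAddSubmonoid fun d => ?_
  refine c.mem_relIdeal_of_t_mul_mem_of_mem_piece h (d.toNat + 1) d (by omega)
    (proj_mem_piece h d x) ?_
  have := c.proj_mem_relIdeal h hx (d + 2)
  rwa [proj_t_mul, add_sub_cancel_right] at this

end ConstantCocycle

end

/-! ### Graded section and construction of the deformation -/

noncomputable section

variable {n : ℕ} {G : Type*} [Group G] {q : Fin n → Fin n → ℂ} {M : G → Fin n → Fin n → ℂ}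
  [MulSemiringAction G (QuantumSym q)] [SMulCommClass G ℂ (QuantumSym q)]
  [MulSemiringAction G (FreePoly n)] [SMulCommClass G ℂ (FreePoly n)]

namespace ConstantCocycle

open Cover

variable (h : CompatibleActions q M) (c : ConstantCocycle q G)

include h c

/-- The specialization has a linear section that preserves degrees. -/
theorem exists_graded_section : ∃ s : QuantumSkew q G →ₗ[ℂ] Cover n G,
    (∀ r, specialize h (s r) = r) ∧
      ∀ d, ∀ r ∈ QuantumSkew.piece q G d, s r ∈ Cover.piece h d := by
  let w : (Σ d : ℤ, Cover.piece h d) → Cover n G := fun p => p.2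
  -- A basis of S_q(V) ⋊ G is extracted from images of homogeneous elements; the section sends each
  -- basis vector to its homogeneous lift.
  obtain ⟨κ, a, -, hspan, hli⟩ := exists_linearIndependent' ℂ fun p => specialize h (w p)
  have htop : ⊤ ≤ Submodule.span ℂ (Set.range ((fun p => specialize h (w p)) ∘ a)) := by
    rw [hspan]
    intro r _
    obtain ⟨y, rfl⟩ := specialize_surjective h r
    refine mem_of_proj_mem h ((Submodule.span ℂ (Set.range fun p => specialize h (w p))).comap
      (specialize h).toLinearMap).toAddSubmonoid fun d => ?_
    exact Submodule.subset_span ⟨⟨d, proj h d y, proj_mem_piece h d y⟩, rfl⟩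
  let b := Module.Basis.mk hli htop
  let s : QuantumSkew q G →ₗ[ℂ] Cover n G := b.constr ℂ fun k => w (a k)
  have hsb : ∀ k, s (b k) = w (a k) := fun k => b.constr_basis ℂ _ k
  have hs : ∀ r, specialize h (s r) = r := by
    have : (specialize h).toLinearMap ∘ₗ s = LinearMap.id := b.ext fun k => by
      rw [LinearMap.comp_apply, hsb, LinearMap.id_apply, Module.Basis.mk_apply]
      rfl
    exact LinearMap.congr_fun this
  have hrange : ∀ d r, ∃ r', proj h d (s r) = s r' := by
    intro d r
    suffices H : r ∈ (LinearMap.range s).comap (proj h d ∘ₗ s) by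
      obtain ⟨r', hr'⟩ := H
      exact ⟨r', hr'.symm⟩
    have hb : Submodule.span ℂ (Set.range b) ≤ (LinearMap.range s).comap (proj h d ∘ₗ s) := by
      rw [Submodule.span_le]
      rintro _ ⟨k, rfl⟩
      have hk : proj h (a k).1 (w (a k)) = w (a k) := (a k).2.2
      change proj h d (s (b k)) ∈ LinearMap.range s
      rw [hsb, ← hk, proj_proj]
      split_ifs
      · rw [hk]; exact ⟨b k, hsb k⟩
      · exact zero_mem _
    exact hb (b.span_eq ▸ trivial)
  refine ⟨s, hs, fun d r hr => ?_⟩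
  obtain ⟨y, hy, hyr⟩ := exists_specialize_eq h hr
  obtain ⟨r', hr'⟩ := hrange d r
  -- The kernel of the specialization is stable under projections, which forces r' = r.
  obtain ⟨j, hj, z, hz⟩ := c.exists_eq_add_t_mul h (x := s r - y) (by rw [map_sub, hs, hyr, sub_self])
  have h1 := congrArg (fun x => specialize h (proj h d x)) hz
  simp only [map_sub, map_add, proj_t_mul, map_mul, specialize_t, zero_mul, add_zero,
    c.specialize_eq_zero h (c.proj_mem_relIdeal h hj d), hr', (mem_piece h).1 hy, hs, hyr,
    sub_eq_zero] at h1
  rw [mem_piece, hr', h1]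

omit c
/-- Every constant cocycle that vanishes on `1` lifts to a deformation. -/
theorem exists_deformation (c : ConstantCocycle q G) :
    ∃ D : Deformation (QuantumSkew q G), D.μ 1 = c.toFun := by
  obtain ⟨s, hs, hsd⟩ := c.exists_graded_section h
  let f : QuantumSkew q G →ₗ[ℂ] QuantumSkew q G := c.correction h ∘ₗ s
  have hfd : ∀ d, ∀ r ∈ QuantumSkew.piece q G d, f r ∈ QuantumSkew.piece q G (d - 2) :=
    fun d r hr => c.correction_mem_piece h (hsd d r hr)
  let p : Cover n G →ₐ[ℂ] Cover n G ⧸ c.relIdeal := Ideal.Quotient.mkₐ ℂ c.relIdeal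
  have hp : ∀ x, p x = 0 ↔ x ∈ c.relIdeal := fun x => Ideal.Quotient.eq_zero_iff_mem
  have hps : Function.Surjective p := Ideal.Quotient.mkₐ_surjective ℂ c.relIdeal
  let π : (Cover n G ⧸ c.relIdeal) →ₐ[ℂ] TwistedExt c.toUnitalTwoCocycle :=
    Ideal.Quotient.liftₐ c.relIdeal (c.toTwisted h) fun x hx => c.toTwisted_eq_zero h hx
  have hπ : ∀ x, π (p x) = c.toTwisted h x := fun x => rfl
  -- π sends the class of s r to (r, f r); subtracting t s(f r) makes the second component zero.
  let σ : QuantumSkew q G →ₗ[ℂ] Cover n G ⧸ c.relIdeal :=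
    p.toLinearMap ∘ₗ (s - LinearMap.mulLeft ℂ (t n G) ∘ₗ s ∘ₗ f)
  have hσ : ∀ r, σ r = p (s r - t n G * s (f r)) := fun r => rfl
  refine exists_deformation_of_flat c.toUnitalTwoCocycle (p (t n G)) (fun x => ?_) σ π
    (fun r => ?_) ?_ (fun x hx => ?_) (fun P hσP htP => ?_)
  · obtain ⟨x, rfl⟩ := hps x
    rw [← map_mul, ← map_mul, t_mul_comm h]
  · rw [hσ, hπ, map_sub, toTwisted_t_mul, toTwisted_eq, hs, hs]
    ext1
    · simp
    · simp [f]
  · rw [hπ, toTwisted_t]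
  · obtain ⟨x, rfl⟩ := hps x
    rw [← map_mul, hp] at hx
    exact (hp x).2 (c.mem_relIdeal_of_t_mul_mem h hx)
  -- Induction on the degree: x minus the section of its specialization lies in the ideal plus t
  -- times degree d - 2.
  · have key : ∀ (m : ℕ) (d : ℤ), d < m → ∀ x ∈ Cover.piece h d, p x ∈ P := by
      intro m
      induction m with
      | zero =>
        intro d hd x hx
        rw [eq_zero_of_mem_piece h (by simpa using hd) hx, map_zero]
        exact zero_mem _
      | succ m ih =>
        intro d hd x hx
        push_cast at hd
        have hφ := specialize_mem_piece h hx
        obtain ⟨j, hj, y, hy, hxy⟩ := c.exists_eq_add_t_mul_of_mem_piece h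
          (sub_mem hx (hsd d _ hφ)) (by rw [map_sub, hs, sub_self])
        have h1 : p x = σ (specialize h x) + p (t n G) * p (s (f (specialize h x))) +
            p (t n G) * p y := by
          have h2 : x = (s (specialize h x) - t n G * s (f (specialize h x))) +
              t n G * s (f (specialize h x)) + (j + t n G * y) := by
            rw [← hxy]; abel
          rw [hσ, ← map_mul, ← map_mul]
          conv_lhs => rw [h2]
          rw [map_add, map_add, map_add p j, (hp j).2 hj, zero_add]
        rw [h1]
        exact add_mem (add_mem (hσP _)
          (htP _ (ih (d - 2) (by omega) _ (hsd _ _ (hfd _ _ hφ)))))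
          (htP _ (ih (d - 2) (by omega) _ hy))
    refine eq_top_iff.2 fun x _ => ?_
    obtain ⟨x, rfl⟩ := hps x
    exact mem_of_proj_mem h (P.comap p.toLinearMap).toAddSubmonoid fun d =>
      key (d.toNat + 1) d (by omega) _ (proj_mem_piece h d x)

end ConstantCocycle

/-! ### Linear actions on the free algebra and the conclusion -/

namespace FreePoly

theorem algHom_ext {n : ℕ} {A : Type*} [Ring A] [Algebra ℂ A] {f g : FreePoly n →ₐ[ℂ] A}
    (hv : ∀ i, f (var i) = g (var i)) (ht : f Polynomial.X = g Polynomial.X) : f = g := by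
  have : f.toLinearMap = g.toLinearMap := linearMap_ext (by simp)
    (fun i x hx => by
      replace hx : f x = g x := hx
      change f _ = g _
      rw [map_mul, map_mul, hx, hv])
    (fun x hx => by
      replace hx : f x = g x := hx
      change f _ = g _
      rw [map_mul, map_mul, hx, ht])
  exact AlgHom.toLinearMap_injective this

/-- The endomorphism that acts on the generators by a matrix and fixes the central variable. -/
def matrixHom {n : ℕ} (m : Fin n → Fin n → ℂ) : FreePoly n →ₐ[ℂ] FreePoly n :=
  lift (fun i => ∑ k, m k i • var k) Polynomial.X fun _ => Polynomial.X_mul.symm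

/-- The action of a group on the free algebra defined by a matrix representation. -/
abbrev matrixAction {n : ℕ} {G : Type*} [Group G] (M : G → Fin n → Fin n → ℂ)
    (h1 : ∀ k i, M 1 k i = if k = i then 1 else 0)
    (hmul : ∀ g g' k i, M (g * g') k i = ∑ l, M g k l * M g' l i) :
    MulSemiringAction G (FreePoly n) where
  smul g y := matrixHom (M g) y
  one_smul y := by
    have : matrixHom (M 1) = AlgHom.id ℂ (FreePoly n) :=
      algHom_ext (fun i => by simp [matrixHom, h1]) (by simp [matrixHom])
    exact DFunLike.congr_fun this y
  mul_smul g g' y := by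
    have : matrixHom (M (g * g')) = (matrixHom (M g)).comp (matrixHom (M g')) := by
      refine algHom_ext (fun i => ?_) (by simp [matrixHom])
      simp only [matrixHom, AlgHom.comp_apply, lift_var, map_sum, map_smul, hmul, Finset.sum_smul,
        Finset.smul_sum, smul_smul]
      rw [Finset.sum_comm]
      simp only [mul_comm]
    exact DFunLike.congr_fun this y
  smul_zero g := map_zero (matrixHom (M g))
  smul_add g := map_add (matrixHom (M g))
  smul_one g := map_one (matrixHom (M g))
  smul_mul g := map_mul (matrixHom (M g))

end FreePoly

end

theorem theorem4p4 {n : ℕ} {V G : Type*} [AddCommGroup V] [Module ℂ V] [Group G] [Finite G]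
    (v : Module.Basis (Fin n) ℂ V) (ρ : Representation ℂ G V)
    (q : Fin n → Fin n → ℂ) (hq_ne : ∀ i j, q i j ≠ 0) (hq_diag : ∀ i, q i i = 1)
    (hq_inv : ∀ i j, q j i = (q i j)⁻¹)
    -- the induced action of `G` on `S_q(V)` by algebra automorphisms
    [MulSemiringAction G (QuantumSym q)] [SMulCommClass G ℂ (QuantumSym q)]
    (hS : ∀ (g : G) (x : V), g • SkewCommAlgebra.incl v q x = SkewCommAlgebra.incl v q (ρ g x))
    -- the action of `G` on `V` extends to `⋀_q(V)` by algebra automorphisms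
    (hE : ∃ ψ : G →* (QuantumExt q ≃ₐ[ℂ] QuantumExt q), ∀ (g : G) (x : V),
      ψ g (SkewCommAlgebra.incl v (fun i j => - q i j) x) =
        SkewCommAlgebra.incl v (fun i j => - q i j) (ρ g x))
    (α : SkewGroupAlgebra (QuantumSym q) G →ₗ[ℂ]
      SkewGroupAlgebra (QuantumSym q) G →ₗ[ℂ] SkewGroupAlgebra (QuantumSym q) G)
    (hα : IsHochschildTwoCocycle (R := SkewGroupAlgebra (QuantumSym q) G) α) (hα_const : IsConstantCochain α) :
    ∃ D : Deformation (SkewGroupAlgebra (QuantumSym q) G), D.μ 1 = α := by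
  let M : G → Fin n → Fin n → ℂ := fun g k i => v.repr (ρ g (v i)) k
  have hM : ∀ g i, ρ g (v i) = ∑ k, M g k i • v k := fun g i => (v.sum_repr _).symm
  let act : MulSemiringAction G (FreePoly n) := FreePoly.matrixAction M
    (fun k i => by
      simp only [M, map_one, Module.End.one_apply, Module.Basis.repr_self, Finsupp.single_apply,
        eq_comm])
    (fun g g' k i => by
      change v.repr (ρ (g * g') (v i)) k = _
      rw [map_mul, Module.End.mul_apply, hM g' i, map_sum, map_sum, Finsupp.finsetSum_apply]
      refine Finset.sum_congr rfl fun l _ => ?_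
      rw [map_smul, map_smul, Finsupp.smul_apply, smul_eq_mul, mul_comm])
  have : SMulCommClass G ℂ (FreePoly n) := ⟨fun g z y => map_smul (FreePoly.matrixHom (M g)) z y⟩
  have hM' : CompatibleActions q M :=
    { q_diag := hq_diag
      q_inv := fun i j => by rw [hq_inv i j, mul_inv_cancel₀ (hq_ne i j)]
      smul_gen := fun g i => by
        have hv : ∀ i, SkewCommAlgebra.incl v q (v i) = SkewCommAlgebra.gen q i := fun i =>
          v.constr_basis ℂ _ i
        have := hS g (v i)
        rw [hM, map_sum, hv] at this
        simpa only [map_smul, hv] using this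
      smul_var := fun g i => FreePoly.lift_var _ _ _ i
      smul_X := fun g => FreePoly.lift_X _ _ _ }
  have hpiece : ∀ d (x : QuantumSkew q G), x ∈ QuantumSkew.piece q G d ↔ x ∈ skewPiece q G d :=
    fun d x => QuantumSkew.mem_piece
  let α' : QuantumSkew q G →ₗ[ℂ] QuantumSkew q G →ₗ[ℂ] QuantumSkew q G := α
  have hα' : IsHochschildTwoCocycle α' := hα
  have hc : ∀ d e x y, x ∈ QuantumSkew.piece q G d → y ∈ QuantumSkew.piece q G e →
      α' x y ∈ QuantumSkew.piece q G (d + e - 2) := fun d e x y hx hy =>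
    (hpiece _ _).2 (hα_const d e x y ((hpiece _ _).1 hx) ((hpiece _ _).1 hy))
  -- α(1, 1) has degree -2, hence is zero; the cocycle identity at (1, 1, r) and (r, 1, 1) then
  -- makes α vanish whenever an argument is 1.
  have h11 : α' 1 1 = 0 := QuantumSkew.eq_zero_of_mem_piece (by norm_num)
    (hc 0 0 1 1 QuantumSkew.one_mem_piece QuantumSkew.one_mem_piece)
  let c : ConstantCocycle q G :=
    { toFun := α'
      cocycle := hα'
      one_left := fun r => by simpa [h11] using (hα' 1 1 r).symm
      one_right := fun r => by simpa [h11] using hα' r 1 1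
      constant := hc }
  exact c.exists_deformation hM'
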